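/- For integers $k,n\ge 1$ let $d_k(n)$ be the number of ordered $k$-tuples of positive integers with product $n$. For real $\rho,x>0$ put $$\Psi_{\rho,k}(x)=\frac{\pi^{k/2-1}}{2^{k-1}}\sum_{j=1}^{\infty}d_k(j)\,G_{0,2k}^{k+1,0}\!\left(\begin{matrix}-\\ (0)_k,\tfrac12:(\tfrac12)_{k-1}\end{matrix}\,\Big|\,\frac{\rho^2j^2x^2}{2^{2k}}\right),$$ where the lower parameters are $k$ zeros followed by $k$ halves, so that the Meijer $G$-function is $$G_{0,2k}^{k+1,0}\!\left(\begin{matrix}-\\ (0)_k,\tfrac12:(\tfrac12)_{k-1}\end{matrix}\,\Big|\,z\right)=\frac1{2\pi i}\int_{C-i\infty}^{C+i\infty}\frac{\Gamma(-s)^k\,\Gamma(\frac12-s)}{\Gamma(\frac12+s)^{k-1}}\,z^s\,ds\qquad(z>0)$$ with an arbitrary $C<0$. Let $m$ be an odd integer (positive or negative), let $\zeta$ be the Riemann zeta function, $\Gamma$ the Gamma function and $B_j$ the Bernoulli numbers. **Theorem 1.7 (generalized Lerch identity).** For every integer $k\ge1$ and every $C<0$, all the integrals and series in \begin{align*} \sum_{n=1}^{\infty}\frac{d_k(n)}{n^{2m+1}}\Psi_{(2\pi)^k,k}(n)={}&\frac1{(k-1)!}\,\frac{d^{k-1}}{ds^{k-1}}\left(\zeta^k(2m+1+s)\,\zeta^k(s)\,\Gamma^k(s+1)\cos^{k-1}\!\left(\frac{\pi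 s}{2}\right)(2\pi)^{-ks}\right)\bigg|_{s=0}\\ &+2^{2km-k}\,\pi^{2km+2k-1}\sum_{n=0}^{m+1}(-1)^{n+1}\frac{B_{2m-2n+2}^k\,B_{2n}^k}{\big((2m-2n+2)!\,(2n)!\big)^k} \end{align*} converge absolutely and the identity holds; the last sum is empty if $m+1<0$. In particular, for $k=1$ one has $\Psi_{2\pi,1}(n)=1/(e^{2\pi n}-1)$ for all $n\ge1$, and the identity becomes Lerch's identity $$\zeta(2m+1)+2\sum_{n=1}^{\infty}\frac{1}{n^{2m+1}(e^{2\pi n}-1)}=2^{2m}\pi^{2m+1}\sum_{j=0}^{m+1}(-1)^{j+1}\frac{B_{2j}\,B_{2m+2-2j}}{(2j)!\,(2m+2-2j)!},$$ where the series converges absolutely. -/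

import Mathlib

noncomputable section

/-- The Piltz divisor function `d_k(n)`: the number of ordered `k`-tuples of positive integers
with product `n` (and `0` for `n = 0`). -/
def piltz (k n : ℕ) : ℕ := (Nat.finMulAntidiag k n).card

/-- The integrand
`∏_{j ≤ m} Γ(b_j - s) ∏_{j ≤ n} Γ(1 - a_j + s) / (∏_{j > m} Γ(1 - b_j + s) ∏_{j > n} Γ(a_j - s)) * z ^ s`
of the Meijer function `G^{m,n}_{p,q}`. The parameters are indexed from `0`, so that the first `m`
of the `b_j` are those with `j < m`. -/
def meijerIntegrand {p q : ℕ} (m n : ℕ) (a : Fin p → ℂ) (b : Fin q → ℂ) (z s : ℂ) : ℂ :=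
  ((∏ j : Fin q with j.val < m, Complex.Gamma (b j - s)) *
      (∏ j : Fin p with j.val < n, Complex.Gamma (1 - a j + s))) /
    ((∏ j : Fin q with m ≤ j.val, Complex.Gamma (1 - b j + s)) *
      (∏ j : Fin p with n ≤ j.val, Complex.Gamma (a j - s))) * z ^ s

/-- The Meijer function `G^{m,n}_{p,q}(a; b | z)`, as `1 / (2 π i)` times the integral of the
integrand over the vertical line `Re s = C` (parametrized by `s = C + i y`, `ds = i dy`). The line
has to separate the poles of the factors `Γ(b_j - s)`, `j ≤ m`, which lie to its right, from those
of the factors `Γ(1 - a_j + s)`, `j ≤ n`, which lie to its left. -/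
def meijerG {p q : ℕ} (m n : ℕ) (a : Fin p → ℂ) (b : Fin q → ℂ) (C : ℝ) (z : ℂ) : ℂ :=
  1 / (2 * Real.pi * Complex.I) *
    ∫ y : ℝ, meijerIntegrand m n a b z (C + y * Complex.I) * Complex.I

/-- The lower parameters `(0)_k, 1/2 : (1/2)_{k-1}` in the definition of `Ψ_{ρ,k}`:
`k` zeros followed by `k` halves. -/
def psiParam (k : ℕ) (j : Fin (2 * k)) : ℂ := if (j : ℕ) < k then 0 else 1 / 2

/-- The `j`-th term `d_k(j) G^{k+1,0}_{0,2k}(- ; (0)_k, 1/2 : (1/2)_{k-1} | ρ² j² x² / 2^{2k})` of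
the series `Ψ_{ρ,k}(x)`. The poles of `Γ(-s)` and `Γ(1/2 - s)` are to the right of the line
`Re s = C` exactly when `C < 0`. -/
def psiTerm (C ρ : ℝ) (k : ℕ) (x : ℝ) (j : ℕ) : ℂ :=
  (piltz k j : ℂ) *
    meijerG (k + 1) 0 (Fin.elim0 : Fin 0 → ℂ) (psiParam k) C
      ((ρ ^ 2 * (j : ℝ) ^ 2 * x ^ 2 / 2 ^ (2 * k) : ℝ) : ℂ)

/-- The function `Ψ_{ρ,k}(x)`, with the `G`-functions in it taken over the line `Re s = C`. -/
def psi (C ρ : ℝ) (k : ℕ) (x : ℝ) : ℂ :=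
  ((Real.pi ^ ((k : ℝ) / 2 - 1) / 2 ^ (k - 1) : ℝ) : ℂ) * ∑' j : ℕ+, psiTerm C ρ k x j

/-- The finite sum
`∑_{n=0}^{m+1} (-1)^{n+1} B_{2m-2n+2}^k B_{2n}^k / ((2m-2n+2)! (2n)!)^k`, empty if `m + 1 < 0`. -/
def bernoulliSum (m : ℤ) (k : ℕ) : ℂ :=
  ∑ n ∈ Finset.Icc (0 : ℤ) (m + 1),
    (-1 : ℂ) ^ (n + 1) *
      ((bernoulli (2 * m - 2 * n + 2).toNat : ℂ) ^ k * (bernoulli (2 * n).toNat : ℂ) ^ k) /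
        (((2 * m - 2 * n + 2).toNat.factorial : ℂ) * ((2 * n).toNat.factorial : ℂ)) ^ k

end

/-! Put `s = -w/2` in the Meijer integral. The duplication and reflection formulas of Γ turn its
integrand, up to constants, into `Γ(w)^k cos(πw/2)^(k-1) Y^(-w)` with `Y = ρ j x`. Summing over `j`
on a line `Re w = c > 1` produces `ζ(w)^k`. Summing `d_k(n) n^(-2m-1) Ψ(n)` over `n` produces a
second factor `ζ(2m+1+w)^k`, once `2m+1+c > 1`. So the series is `1/(2πi)` times the integral over
`Re w = c` of `Γ(w)^k cos(πw/2)^(k-1) ρ^(-w) ζ(w)^k ζ(2m+1+w)^k` (`hasSum_lerch`).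

For `ρ = (2π)^k` the functional equation of ζ rewrites this kernel as `F(w) = 2^(-k) ζ(1-w)^k
ζ(2m+1+w)^k / cos(πw/2)`. Since `m` is odd, `F(-2m-w) = -F(w)` (`lerchReflected_reflect`). Hence the
integrals over `Re w = 2M` and over the mirror line `Re w = -2m-2M` are opposite, and each is
determined by their difference, which is a sum of residues: the series equals half the sum of the
residues of `F` between the two lines (`integral_lerchReflected`).

The poles at `0` and `-2m` have equal residues by the symmetry; their half-sum is the derivative
term. The zeros `1-2n` of the cosine give `ζ(2n)^k ζ(2m+2-2n)^k`; the trivial zeros of ζ remove all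
but `0 ≤ n ≤ m+1`, and Euler's formula turns the rest into Bernoulli numbers (`sum_oddResidue`).

Convergence rests on growth in vertical strips: Γ decays like `exp(-π|y|/2)` up to powers of `1 +
|y|`, the cosine grows at most like `exp(π|y|/2)`, and ζ grows polynomially. One exponential factor
is left over in both forms of the kernel. For `k = 1` the kernel is Γ, the Mellin transform of
`exp(-x)`, and `Ψ` is a geometric series. -/

noncomputable section

/-! ### Growth of ζ for `Re s ≥ 1/2` -/

/-- The difference between `(n + 1) ^ (-s)` and the integral of `x ^ (-s)` over
`[n + 1, n + 2]`. -/
def zetaTerm (n : ℕ) (s : ℂ) : ℂ :=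
  (((n : ℝ) + 1 : ℝ) : ℂ) ^ (-s) -
    ((((n : ℝ) + 2 : ℝ) : ℂ) ^ (1 - s) - (((n : ℝ) + 1 : ℝ) : ℂ) ^ (1 - s)) / (1 - s)

lemma norm_cpow_neg_sub_le {N x : ℝ} (hN : 0 < N) (hx : x ∈ Set.Icc N (N + 1)) {s : ℂ}
    (hs : 0 < s.re) :
    ‖(x : ℂ) ^ (-s) - (N : ℂ) ^ (-s)‖ ≤ ‖s‖ * N ^ (-s.re - 1) := by
  have hs0 : -s ≠ 0 := by
    intro h
    have := congrArg Complex.re h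
    simp at this
    linarith
  have key := Convex.norm_image_sub_le_of_norm_hasDerivWithin_le (𝕜 := ℝ)
    (f := fun y : ℝ => (y : ℂ) ^ (-s)) (f' := fun y : ℝ => (-s) * (y : ℂ) ^ (-s - 1))
    (s := Set.Icc N (N + 1)) (x := N) (y := x) (C := ‖s‖ * N ^ (-s.re - 1))
    (fun y hy => (hasDerivAt_ofReal_cpow_const (by linarith [hy.1]) hs0).hasDerivWithinAt)
    (fun y hy => by
      have hy0 : 0 < y := by linarith [hy.1]
      rw [norm_mul, norm_neg, Complex.norm_cpow_eq_rpow_re_of_pos hy0]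
      refine mul_le_mul_of_nonneg_left ?_ (norm_nonneg _)
      simp only [Complex.sub_re, Complex.neg_re, Complex.one_re]
      exact Real.rpow_le_rpow_of_nonpos hN hy.1 (by linarith))
    (convex_Icc _ _) (by simp) hx
  refine key.trans ?_
  have : ‖x - N‖ ≤ 1 := by
    rw [Real.norm_of_nonneg (by linarith [hx.1])]
    linarith [hx.2]
  exact mul_le_of_le_one_right (by positivity) this

/-- Up to sign the term is the integral of `y^(-s) - N^(-s)` over `[N, N+1]`. The mean value
inequality is applied to the explicit primitive, so no integral appears. The gain of one power of
`N` gives convergence for `Re s > 0`. -/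
lemma norm_zetaTerm_le (n : ℕ) {s : ℂ} (hs : 0 < s.re) (hs1 : s ≠ 1) :
    ‖zetaTerm n s‖ ≤ ‖s‖ * ((n : ℝ) + 1) ^ (-s.re - 1) := by
  have hs1' : 1 - s ≠ 0 := sub_ne_zero.mpr hs1.symm
  set N : ℝ := (n : ℝ) + 1 with hNdef
  have hN : 0 < N := by positivity
  have hN2 : (n : ℝ) + 2 = N + 1 := by rw [hNdef]; ring
  have key := Convex.norm_image_sub_le_of_norm_hasDerivWithin_le (𝕜 := ℝ)
    (f := fun y : ℝ => (y : ℂ) ^ (1 - s) / (1 - s) - y * (N : ℂ) ^ (-s))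
    (f' := fun y : ℝ => (y : ℂ) ^ (-s) - (N : ℂ) ^ (-s))
    (s := Set.Icc N (N + 1)) (x := N) (y := N + 1) (C := ‖s‖ * N ^ (-s.re - 1))
    (fun y hy => by
      have h1 := (hasDerivAt_ofReal_cpow_const (x := y) (by linarith [hy.1]) hs1').div_const (1 - s)
      have h2 := (Complex.ofRealCLM.hasDerivAt (x := y)).mul_const ((N : ℂ) ^ (-s))
      have h3 := h1.sub h2
      refine (h3.congr_deriv ?_).hasDerivWithinAt
      have : 1 - s - 1 = -s := by ring
      rw [this]
      simp
      field_simp)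
    (fun y hy => norm_cpow_neg_sub_le hN hy hs)
    (convex_Icc _ _) (by simp) (by simp)
  rw [zetaTerm, hN2, ← hNdef, ← norm_neg]
  refine le_trans (le_of_eq ?_) (key.trans (le_of_eq ?_))
  · congr 1
    push_cast
    ring
  · simp

lemma differentiableAt_zetaTerm (n : ℕ) {s : ℂ} (hs1 : s ≠ 1) :
    DifferentiableAt ℂ (zetaTerm n) s := by
  have hs1' : 1 - s ≠ 0 := sub_ne_zero.mpr hs1.symm
  have h1 : (((n : ℝ) + 1 : ℝ) : ℂ) ≠ 0 := by exact_mod_cast Nat.succ_ne_zero n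
  have h2 : (((n : ℝ) + 2 : ℝ) : ℂ) ≠ 0 := by exact_mod_cast Nat.succ_ne_zero (n + 1)
  have e1 : DifferentiableAt ℂ (fun s : ℂ => -s) s := by fun_prop
  have e2 : DifferentiableAt ℂ (fun s : ℂ => 1 - s) s := by fun_prop
  exact (e1.const_cpow (Or.inl h1)).sub
    (((e2.const_cpow (Or.inl h2)).sub (e2.const_cpow (Or.inl h1))).div e2 hs1')

lemma summable_nat_add_one_rpow {σ : ℝ} (hσ : 1 < σ) :
    Summable (fun n : ℕ => ((n : ℝ) + 1) ^ (-σ)) := by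
  have := (summable_nat_add_iff 1).mpr (Real.summable_nat_rpow.mpr (show -σ < -1 by linarith))
  simpa using this

lemma tsum_zetaTerm_of_one_lt_re {s : ℂ} (hs : 1 < s.re) :
    ∑' n, zetaTerm n s = riemannZeta s - 1 / (s - 1) := by
  have hs1 : s ≠ 1 := by rintro rfl; simp at hs
  have hs1' : 1 - s ≠ 0 := sub_ne_zero.mpr hs1.symm
  have hs1'' : s - 1 ≠ 0 := sub_ne_zero.mpr hs1
  have hsum : Summable (fun n : ℕ => (((n : ℝ) + 1 : ℝ) : ℂ) ^ (-s)) := by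
    refine Summable.of_norm ((summable_nat_add_one_rpow hs).congr fun n => ?_)
    rw [Complex.norm_cpow_eq_rpow_re_of_pos (by positivity), Complex.neg_re]
  have hz : HasSum (fun n : ℕ => (((n : ℝ) + 1 : ℝ) : ℂ) ^ (-s)) (riemannZeta s) := by
    rw [zeta_eq_tsum_one_div_nat_add_one_cpow hs]
    have := hsum.hasSum
    convert this using 3 with n
    rw [Complex.cpow_neg, one_div]
    push_cast
    rfl
  have hlim : Filter.Tendsto (fun n : ℕ => (((n : ℝ) + 1 : ℝ) : ℂ) ^ (1 - s)) Filter.atTop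
      (nhds 0) := by
    rw [tendsto_zero_iff_norm_tendsto_zero]
    have : Filter.Tendsto (fun n : ℕ => ((n : ℝ) + 1) ^ (-(s.re - 1))) Filter.atTop (nhds 0) :=
      (tendsto_rpow_neg_atTop (by linarith)).comp
        (Filter.tendsto_atTop_add_const_right _ _ tendsto_natCast_atTop_atTop)
    refine this.congr fun n => ?_
    rw [Complex.norm_cpow_eq_rpow_re_of_pos (by positivity)]
    congr 1
    simp
  have hsummable : Summable (fun n => zetaTerm n s) := by
    refine Summable.of_norm_bounded (g := fun n : ℕ => ‖s‖ * ((n : ℝ) + 1) ^ (-s.re - 1))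
      (((summable_nat_add_one_rpow (σ := s.re + 1) (by linarith)).mul_left ‖s‖).congr fun n => ?_)
      (fun n => norm_zetaTerm_le n (by linarith) hs1)
    congr 2
    ring
  refine HasSum.tsum_eq (hsummable.hasSum_iff_tendsto_nat.mpr ?_)
  have hpart : ∀ M : ℕ, ∑ n ∈ Finset.range M, zetaTerm n s =
      ∑ n ∈ Finset.range M, (((n : ℝ) + 1 : ℝ) : ℂ) ^ (-s) -
        ((((M : ℝ) + 1 : ℝ) : ℂ) ^ (1 - s) - 1) / (1 - s) := by
    intro M
    induction M with
    | zero => simp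
    | succ M ih =>
      rw [Finset.sum_range_succ, ih, Finset.sum_range_succ, zetaTerm]
      have : (((M + 1 : ℕ) : ℝ) + 1) = (M : ℝ) + 2 := by push_cast; ring
      rw [this]
      ring
  simp_rw [hpart]
  have := hz.tendsto_sum_nat.sub ((hlim.sub_const 1).div_const (1 - s))
  convert this using 2
  rw [zero_sub, ← neg_sub s 1, neg_div_neg_eq]

/-- Analytic continuation from `Re s > 1`. The open first quadrant is convex and avoids the pole at
`1`; the lower half-plane is later reached by conjugation. -/
lemma riemannZeta_eq_tsum_zetaTerm {s : ℂ} (hs : 0 < s.re) (hi : 0 < s.im) :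
    riemannZeta s = 1 / (s - 1) + ∑' n, zetaTerm n s := by
  have hne : ∀ z : ℂ, 0 < z.im → z ≠ 1 := by
    rintro z hz rfl
    simp at hz
  -- Cutting off at `δ < Re z` and `‖z‖ < R` makes the bound on the terms uniform in `z`.
  have hdiff : ∀ δ : ℝ, 0 < δ → ∀ R : ℝ, DifferentiableOn ℂ (fun z => ∑' n, zetaTerm n z)
      ({z | δ < z.re} ∩ {z | 0 < z.im} ∩ Metric.ball 0 R) := by
    intro δ hδ R
    refine Complex.differentiableOn_tsum_of_summable_norm
      (u := fun n : ℕ => R * ((n : ℝ) + 1) ^ (-(δ + 1)))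
      ((summable_nat_add_one_rpow (σ := δ + 1) (by linarith)).mul_left R)
      (fun n z hz => (differentiableAt_zetaTerm n (hne z hz.1.2)).differentiableWithinAt)
      (((isOpen_lt continuous_const Complex.continuous_re).inter
        (isOpen_lt continuous_const Complex.continuous_im)).inter Metric.isOpen_ball) ?_
    rintro n z ⟨⟨hz1, hz2⟩, hz3⟩
    simp only [Set.mem_ofPred_eq] at hz1 hz2
    have hzR : ‖z‖ < R := by simpa using hz3
    refine (norm_zetaTerm_le n (hδ.trans hz1) (hne z hz2)).trans ?_
    refine mul_le_mul hzR.le ?_ (by positivity) ((norm_nonneg z).trans hzR.le)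
    exact Real.rpow_le_rpow_of_exponent_le (by linarith [n.cast_nonneg (α := ℝ)]) (by linarith)
  set U : Set ℂ := {z | 0 < z.re} ∩ {z | 0 < z.im} with hU
  have hUo : IsOpen U := (isOpen_lt continuous_const Complex.continuous_re).inter
        (isOpen_lt continuous_const Complex.continuous_im)
  have hUc : Convex ℝ U := (convex_halfSpace_re_gt 0).inter (convex_halfSpace_im_gt 0)
  have hf : DifferentiableOn ℂ (fun z => 1 / (z - 1) + ∑' n, zetaTerm n z) U := by
    intro z hz
    refine DifferentiableAt.differentiableWithinAt (DifferentiableAt.add ?_ ?_)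
    · exact (differentiableAt_const _).div (by fun_prop) (sub_ne_zero.mpr (hne z hz.2))
    · refine (hdiff (z.re / 2) (half_pos hz.1) (‖z‖ + 1)).differentiableAt (IsOpen.mem_nhds
        (((isOpen_lt continuous_const Complex.continuous_re).inter
        (isOpen_lt continuous_const Complex.continuous_im)).inter Metric.isOpen_ball) ?_)
      exact ⟨⟨half_lt_self (a := z.re) hz.1, hz.2⟩, by simp⟩
  have hg : DifferentiableOn ℂ riemannZeta U := fun z hz =>
    (differentiableAt_riemannZeta (hne z hz.2)).differentiableWithinAt
  refine AnalyticOnNhd.eqOn_of_preconnected_of_eventuallyEq (hg.analyticOnNhd hUo)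
    (hf.analyticOnNhd hUo) hUc.isPreconnected (z₀ := 2 + Complex.I) (by simp [hU]) ?_ ⟨hs, hi⟩
  have : {z : ℂ | 1 < z.re} ∈ nhds (2 + Complex.I) :=
    (isOpen_lt continuous_const Complex.continuous_re).mem_nhds (by simp)
  filter_upwards [this] with z hz
  rw [tsum_zetaTerm_of_one_lt_re hz]
  ring

lemma norm_riemannZeta_le_of_half_le_re :
    ∃ A : ℝ, 0 ≤ A ∧ ∀ s : ℂ, 1 / 2 ≤ s.re → 1 ≤ |s.im| → ‖riemannZeta s‖ ≤ A * (1 + ‖s‖) := by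
  have hsum : Summable (fun n : ℕ => ((n : ℝ) + 1) ^ (-(3 / 2 : ℝ))) :=
    summable_nat_add_one_rpow (by norm_num)
  set A := ∑' n : ℕ, ((n : ℝ) + 1) ^ (-(3 / 2 : ℝ)) with hA
  have hA0 : 0 ≤ A := tsum_nonneg fun n => by positivity
  have key : ∀ s : ℂ, 1 / 2 ≤ s.re → 1 ≤ s.im → ‖riemannZeta s‖ ≤ (A + 1) * (1 + ‖s‖) := by
    intro s hs hi
    have hs1 : s ≠ 1 := by rintro rfl; norm_num at hi
    rw [riemannZeta_eq_tsum_zetaTerm (by linarith) (by linarith)]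
    have h1 : ‖1 / (s - 1)‖ ≤ 1 := by
      rw [norm_div, norm_one, div_le_one (norm_pos_iff.mpr (sub_ne_zero.mpr hs1))]
      calc (1 : ℝ) ≤ |(s - 1).im| := by
            simpa using hi.trans (le_abs_self _)
        _ ≤ _ := Complex.abs_im_le_norm _
    have h2 : ‖∑' n, zetaTerm n s‖ ≤ ‖s‖ * A := by
      refine tsum_of_norm_bounded (hsum.hasSum.mul_left ‖s‖) fun n => ?_
      refine (norm_zetaTerm_le n (by linarith) hs1).trans ?_
      refine mul_le_mul_of_nonneg_left ?_ (norm_nonneg _)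
      exact Real.rpow_le_rpow_of_exponent_le (by linarith [n.cast_nonneg (α := ℝ)]) (by linarith)
    refine (norm_add_le _ _).trans ?_
    nlinarith [norm_nonneg s]
  refine ⟨A + 1, by linarith, fun s hs hi => ?_⟩
  rcases le_abs.mp hi with h | h
  · exact key s hs h
  · have := key ((starRingEnd ℂ) s) (by simpa using hs) (by simpa using h)
    rwa [riemannZeta_conj, RCLike.norm_conj, RCLike.norm_conj] at this

/-! ### Decay of Γ in vertical strips -/

lemma norm_betaIntegral_le {z : ℂ} {a : ℝ} (hz : 0 < z.re) (ha : 0 < a) :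
    ‖Complex.betaIntegral z a‖ * Real.Gamma (z.re + a) ≤ Real.Gamma z.re * Real.Gamma a := by
  have hreal : Complex.betaIntegral (z.re : ℂ) a =
      ((∫ x in (0 : ℝ)..1, x ^ (z.re - 1) * (1 - x) ^ (a - 1) : ℝ) : ℂ) := by
    rw [Complex.betaIntegral, ← intervalIntegral.integral_ofReal]
    refine intervalIntegral.integral_congr fun x hx => ?_
    rw [Set.uIcc_of_le zero_le_one] at hx
    have h1 : 0 ≤ 1 - x := by linarith [hx.2]
    rw [Complex.ofReal_mul, Complex.ofReal_cpow hx.1, Complex.ofReal_cpow h1]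
    push_cast
    rfl
  have hle : ‖Complex.betaIntegral z a‖ ≤
      ∫ x in (0 : ℝ)..1, x ^ (z.re - 1) * (1 - x) ^ (a - 1) := by
    rw [Complex.betaIntegral]
    refine (intervalIntegral.norm_integral_le_integral_norm zero_le_one).trans (le_of_eq ?_)
    rw [intervalIntegral.integral_of_le zero_le_one, intervalIntegral.integral_of_le zero_le_one,
      MeasureTheory.integral_Ioc_eq_integral_Ioo, MeasureTheory.integral_Ioc_eq_integral_Ioo]
    refine MeasureTheory.setIntegral_congr_fun measurableSet_Ioo fun x hx => ?_
    have h1 : 0 < 1 - x := by linarith [hx.2]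
    have h2 : (1 - (x : ℂ)) = ((1 - x : ℝ) : ℂ) := by push_cast; rfl
    rw [norm_mul, Complex.norm_cpow_eq_rpow_re_of_pos hx.1, h2,
      Complex.norm_cpow_eq_rpow_re_of_pos h1]
    simp
  have hG := Complex.Gamma_mul_Gamma_eq_betaIntegral (s := (z.re : ℂ)) (t := (a : ℂ))
    (by simpa using hz) (by simpa using ha)
  rw [hreal, ← Complex.ofReal_add, Complex.Gamma_ofReal, Complex.Gamma_ofReal,
    Complex.Gamma_ofReal] at hG
  norm_cast at hG
  rw [hG, mul_comm]
  exact mul_le_mul_of_nonneg_left hle (Real.Gamma_pos_of_pos (by linarith)).le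

/-- Along a horizontal half-line `‖Γ z‖ / Γ (re z)` increases with `re z`. -/
lemma norm_Gamma_mul_Gamma_le {z : ℂ} {a : ℝ} (hz : 0 < z.re) (ha : 0 < a) :
    ‖Complex.Gamma z‖ * Real.Gamma (z.re + a) ≤ ‖Complex.Gamma (z + a)‖ * Real.Gamma z.re := by
  have hGa : 0 < Real.Gamma a := Real.Gamma_pos_of_pos ha
  have hG := congrArg norm (Complex.Gamma_mul_Gamma_eq_betaIntegral (s := z) (t := (a : ℂ))
    hz (by simpa using ha))
  rw [norm_mul, norm_mul, Complex.Gamma_ofReal, Complex.norm_real,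
    Real.norm_of_nonneg hGa.le] at hG
  refine le_of_mul_le_mul_right ?_ hGa
  calc ‖Complex.Gamma z‖ * Real.Gamma (z.re + a) * Real.Gamma a
      = ‖Complex.Gamma z‖ * Real.Gamma a * Real.Gamma (z.re + a) := by ring
    _ = ‖Complex.Gamma (z + a)‖ * (‖Complex.betaIntegral z a‖ * Real.Gamma (z.re + a)) := by
        rw [hG]; ring
    _ ≤ ‖Complex.Gamma (z + a)‖ * (Real.Gamma z.re * Real.Gamma a) :=
        mul_le_mul_of_nonneg_left (norm_betaIntegral_le hz ha) (norm_nonneg _)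
    _ = _ := by ring

/-- On `Re z = 1/2` one has `1 - z = conj z`, so the reflection formula gives the exact value `‖Γ
z‖² = π / cosh(πy)`. -/
lemma norm_Gamma_half_add_le (y : ℝ) :
    ‖Complex.Gamma (1 / 2 + y * Complex.I)‖ ≤
      √(2 * Real.pi) * Real.exp (-(Real.pi * |y| / 2)) := by
  have h := Complex.Gamma_mul_Gamma_one_sub (1 / 2 + y * Complex.I)
  have e1 : 1 - (1 / 2 + y * Complex.I) = (starRingEnd ℂ) (1 / 2 + y * Complex.I) := by
    apply Complex.ext <;> simp
    norm_num
  have e2 : Complex.sin (Real.pi * (1 / 2 + y * Complex.I)) = (Real.cosh (Real.pi * y) : ℂ) := by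
    rw [mul_add, mul_one_div, Complex.sin_add, Complex.sin_pi_div_two, Complex.cos_pi_div_two,
      ← mul_assoc, Complex.cos_mul_I]
    simp
  rw [e1, Complex.Gamma_conj, Complex.mul_conj, e2, Complex.normSq_eq_norm_sq] at h
  have h' : ‖Complex.Gamma (1 / 2 + y * Complex.I)‖ ^ 2 = Real.pi / Real.cosh (Real.pi * y) := by
    exact_mod_cast h
  have hcosh : Real.exp (Real.pi * |y|) / 2 ≤ Real.cosh (Real.pi * y) := by
    rw [← Real.cosh_abs, abs_mul, abs_of_pos Real.pi_pos, Real.cosh_eq]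
    linarith [Real.exp_pos (-(Real.pi * |y|))]
  refine abs_le_of_sq_le_sq' ?_ (by positivity) |>.2
  rw [h', mul_pow, Real.sq_sqrt (by positivity), ← Real.exp_nat_mul]
  calc Real.pi / Real.cosh (Real.pi * y) ≤ Real.pi / (Real.exp (Real.pi * |y|) / 2) := by
        gcongr
    _ = 2 * Real.pi * Real.exp (-(Real.pi * |y|)) := by
        rw [Real.exp_neg]
        field_simp
    _ = _ := by
        congr 2
        push_cast
        ring

lemma norm_Gamma_nat_add_half_le (N : ℕ) (y : ℝ) :
    ‖Complex.Gamma (N + 1 / 2 + y * Complex.I)‖ ≤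
      (N + 1 : ℝ) ^ N * √(2 * Real.pi) * ((1 + |y|) ^ N * Real.exp (-(Real.pi * |y| / 2))) := by
  have key : ∀ M : ℕ, M ≤ N → ‖Complex.Gamma (M + 1 / 2 + y * Complex.I)‖ ≤
      ((N + 1 : ℝ) * (1 + |y|)) ^ M * (√(2 * Real.pi) * Real.exp (-(Real.pi * |y| / 2))) := by
    intro M
    induction M with
    | zero => intro _; simpa using norm_Gamma_half_add_le y
    | succ M ih =>
      intro hM
      have hne : (M + 1 / 2 + y * Complex.I : ℂ) ≠ 0 := by
        intro h
        have := congrArg Complex.re h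
        simp at this
        linarith [M.cast_nonneg (α := ℝ)]
      have e : ((M + 1 : ℕ) + 1 / 2 + y * Complex.I : ℂ) = (M + 1 / 2 + y * Complex.I) + 1 := by
        push_cast; ring
      rw [e, Complex.Gamma_add_one _ hne, norm_mul, pow_succ']
      have hb : ‖(M + 1 / 2 + y * Complex.I : ℂ)‖ ≤ (N + 1 : ℝ) * (1 + |y|) := by
        have hMN : (M : ℝ) + 1 ≤ N := by exact_mod_cast hM
        calc ‖(M + 1 / 2 + y * Complex.I : ℂ)‖ ≤ ‖(M + 1 / 2 : ℂ)‖ + ‖(y * Complex.I : ℂ)‖ :=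
              norm_add_le _ _
          _ = M + 1 / 2 + |y| := by
              have : (M + 1 / 2 : ℂ) = ((M + 1 / 2 : ℝ) : ℂ) := by push_cast; rfl
              rw [this, Complex.norm_real, Real.norm_of_nonneg (by positivity)]
              simp
          _ ≤ _ := by nlinarith [abs_nonneg y, M.cast_nonneg (α := ℝ)]
      rw [mul_assoc]
      exact mul_le_mul hb (ih (by omega)) (norm_nonneg _) (by positivity)
  refine (key N le_rfl).trans (le_of_eq ?_)
  rw [mul_pow]
  ring

/-- Monotonicity of `‖Γ z‖ / Γ(Re z)` along horizontals transfers the bound from the line `Re = N +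
1/2`, to the right of the strip, to every point of it. The real factor `Γ(Re z)` is bounded by
compactness. -/
lemma exists_norm_Gamma_le {a b : ℝ} (ha : 0 < a) :
    ∃ A : ℝ, 0 ≤ A ∧ ∃ N : ℕ, ∀ z : ℂ, a ≤ z.re → z.re ≤ b →
      ‖Complex.Gamma z‖ ≤ A * ((1 + |z.im|) ^ N * Real.exp (-(Real.pi * |z.im| / 2))) := by
  obtain ⟨N, hN⟩ := exists_nat_gt b
  have hcont : ContinuousOn Real.Gamma (Set.Icc a b) := fun x hx =>
    (Real.differentiableAt_Gamma (fun m => by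
      have := hx.1
      have := m.cast_nonneg (α := ℝ)
      intro h
      linarith)).continuousAt.continuousWithinAt
  obtain ⟨G, hG⟩ := isCompact_Icc.exists_bound_of_continuousOn hcont
  set L := Real.Gamma (N + 1 / 2) with hL
  have hLpos : 0 < L := Real.Gamma_pos_of_pos (by positivity)
  refine ⟨|G| / L * ((N + 1 : ℝ) ^ N * √(2 * Real.pi)), by positivity, N, fun z hz1 hz2 => ?_⟩
  have h1 := norm_Gamma_mul_Gamma_le (z := z) (a := N + 1 / 2 - z.re) (by linarith) (by linarith)
  have e1 : z.re + (N + 1 / 2 - z.re) = (N + 1 / 2 : ℝ) := by ring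
  have e2 : z + ((N + 1 / 2 - z.re : ℝ) : ℂ) = N + 1 / 2 + z.im * Complex.I := by
    apply Complex.ext <;> simp
  rw [e1, e2, ← hL] at h1
  have h2 := norm_Gamma_nat_add_half_le N z.im
  have h3 : Real.Gamma z.re ≤ |G| := ((le_abs_self _).trans (hG _ ⟨hz1, hz2⟩)).trans (le_abs_self _)
  have h4 : 0 < Real.Gamma z.re := Real.Gamma_pos_of_pos (by linarith)
  rw [← le_div_iff₀ hLpos] at h1
  refine h1.trans ?_
  rw [div_mul_eq_mul_div, div_mul_eq_mul_div]
  refine div_le_div_of_nonneg_right ?_ hLpos.le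
  rw [mul_comm, mul_assoc]
  exact mul_le_mul h3 h2 (norm_nonneg _) (abs_nonneg _)

/-! ### Growth of the kernels and of ζ in strips -/

lemma norm_cos_le_exp_abs_im (z : ℂ) : ‖Complex.cos z‖ ≤ Real.exp |z.im| := by
  rw [Complex.cos]
  have h1 : ‖Complex.exp (z * Complex.I)‖ ≤ Real.exp |z.im| := by
    rw [Complex.norm_exp]
    exact Real.exp_le_exp.mpr (by simpa using neg_le_abs z.im)
  have h2 : ‖Complex.exp (-z * Complex.I)‖ ≤ Real.exp |z.im| := by
    rw [Complex.norm_exp]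
    exact Real.exp_le_exp.mpr (by simpa using le_abs_self z.im)
  rw [norm_div, Complex.norm_two]
  linarith [norm_add_le (Complex.exp (z * Complex.I)) (Complex.exp (-z * Complex.I))]

lemma im_pi_mul_div_two (w : ℂ) : (Real.pi * w / 2 : ℂ).im = Real.pi * w.im / 2 := by
  have : (Real.pi * w / 2 : ℂ) = ((Real.pi / 2 : ℝ) : ℂ) * w := by push_cast; ring
  rw [this, Complex.im_ofReal_mul]
  ring

lemma norm_cos_pi_mul_div_two_le (w : ℂ) :
    ‖Complex.cos (Real.pi * w / 2)‖ ≤ Real.exp (Real.pi * |w.im| / 2) := by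
  refine (norm_cos_le_exp_abs_im _).trans (le_of_eq ?_)
  rw [im_pi_mul_div_two, abs_div, abs_mul, abs_of_pos Real.pi_pos, abs_two]

/-- One term of the series of `exp(1 + |y|)` dominates the power `N + 2`, and `π/2 > 1`. The two
extra powers pay for the integrable majorant `(1 + y²)⁻¹`. -/
lemma one_add_abs_pow_mul_exp_le (N : ℕ) (y : ℝ) :
    (1 + |y|) ^ N * Real.exp (-(Real.pi * |y| / 2)) ≤
      ((N + 2).factorial * Real.exp 1) * (1 + y ^ 2)⁻¹ := by
  have h1 := Real.pow_div_factorial_le_exp (1 + |y|) (by positivity) (N + 2)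
  rw [div_le_iff₀ (by positivity)] at h1
  have h2 : Real.exp (1 + |y|) ≤ Real.exp 1 * Real.exp (Real.pi * |y| / 2) := by
    rw [← Real.exp_add]
    refine Real.exp_le_exp.mpr ?_
    nlinarith [Real.pi_gt_three, abs_nonneg y]
  have h3 : 1 + y ^ 2 ≤ (1 + |y|) ^ 2 := by
    nlinarith [abs_nonneg y, sq_abs y]
  rw [le_mul_inv_iff₀ (by positivity), Real.exp_neg, ← div_eq_mul_inv, div_mul_eq_mul_div,
    div_le_iff₀ (Real.exp_pos _)]
  calc (1 + |y|) ^ N * (1 + y ^ 2) ≤ (1 + |y|) ^ N * (1 + |y|) ^ 2 := by gcongr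
    _ = (1 + |y|) ^ (N + 2) := by ring
    _ ≤ Real.exp (1 + |y|) * (N + 2).factorial := h1
    _ ≤ Real.exp 1 * Real.exp (Real.pi * |y| / 2) * (N + 2).factorial := by gcongr
    _ = _ := by ring

/-- The Mellin transform of the kernel of the series `Ψ_{ρ,k}`. -/
def psiKernel (k : ℕ) (w : ℂ) : ℂ :=
  Complex.Gamma w ^ k * Complex.cos (Real.pi * w / 2) ^ (k - 1)

/-- The `k` exponential decays of Γ face only `k - 1` growths of the cosine, so one factor
`exp(-π|y|/2)` survives. -/
lemma exists_norm_psiKernel_le {k : ℕ} (hk : 1 ≤ k) {a b : ℝ} (ha : 0 < a) :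
    ∃ A : ℝ, 0 ≤ A ∧ ∀ w : ℂ, a ≤ w.re → w.re ≤ b →
      ‖psiKernel k w‖ ≤ A * (1 + w.im ^ 2)⁻¹ := by
  obtain ⟨A, hA, N, h⟩ := exists_norm_Gamma_le (a := a) (b := b) ha
  refine ⟨A ^ k * (((N * k + 2).factorial * Real.exp 1)), by positivity, fun w h1 h2 => ?_⟩
  obtain ⟨l, rfl⟩ : ∃ l, k = l + 1 := ⟨k - 1, by omega⟩
  rw [psiKernel, norm_mul, norm_pow, norm_pow, Nat.add_sub_cancel]
  calc _ ≤ (A * ((1 + |w.im|) ^ N * Real.exp (-(Real.pi * |w.im| / 2)))) ^ (l + 1) *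
        Real.exp (Real.pi * |w.im| / 2) ^ l := by
        gcongr
        · exact h w h1 h2
        · exact norm_cos_pi_mul_div_two_le w
    _ = A ^ (l + 1) * ((1 + |w.im|) ^ (N * (l + 1)) * Real.exp (-(Real.pi * |w.im| / 2))) := by
        rw [mul_pow, mul_pow, ← pow_mul, Real.exp_neg]
        have hE := (Real.exp_pos (Real.pi * |w.im| / 2)).ne'
        generalize Real.exp (Real.pi * |w.im| / 2) = E at hE ⊢
        rw [inv_pow, pow_succ E l]
        field_simp
    _ ≤ A ^ (l + 1) * (((N * (l + 1) + 2).factorial * Real.exp 1) * (1 + w.im ^ 2)⁻¹) := by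
        exact mul_le_mul_of_nonneg_left (one_add_abs_pow_mul_exp_le _ _) (by positivity)
    _ = _ := by ring

lemma exists_norm_riemannZeta_le (a b : ℝ) :
    ∃ A : ℝ, 0 ≤ A ∧ ∃ N : ℕ, ∀ s : ℂ, a ≤ s.re → s.re ≤ b → 1 ≤ |s.im| →
      ‖riemannZeta s‖ ≤ A * (1 + |s.im|) ^ N := by
  obtain ⟨A, hA, h⟩ := norm_riemannZeta_le_of_half_le_re
  obtain ⟨B, hB, N, hG⟩ := exists_norm_Gamma_le (a := 1 / 2) (b := 1 - a) one_half_pos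
  set R := 1 + |a| + |b| with hR
  have hR1 : 1 ≤ R := by linarith [abs_nonneg a, abs_nonneg b]
  have hnorm : ∀ s : ℂ, |s.re| ≤ R → 1 + ‖s‖ ≤ (1 + R) * (1 + |s.im|) := by
    intro s hs
    nlinarith [Complex.norm_le_abs_re_add_abs_im s, abs_nonneg s.im]
  refine ⟨A * (1 + R) + 2 * B * (A * (1 + R)), by positivity, N + 1, fun s h1 h2 h3 => ?_⟩
  have hy : 1 ≤ 1 + |s.im| := by linarith [abs_nonneg s.im]
  rcases le_total (1 / 2) s.re with hs | hs
  · have hre : |s.re| ≤ R := abs_le.mpr ⟨by linarith, by linarith [le_abs_self b, abs_nonneg a]⟩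
    calc ‖riemannZeta s‖ ≤ A * (1 + ‖s‖) := h s hs h3
      _ ≤ A * ((1 + R) * (1 + |s.im|) ^ (N + 1)) := by
          gcongr
          refine (hnorm s hre).trans ?_
          gcongr
          exact le_self_pow₀ hy (by omega)
      _ ≤ _ := by
          have : 0 ≤ 2 * B * (A * (1 + R)) * (1 + |s.im|) ^ (N + 1) := by positivity
          nlinarith
  -- To the left of `1/2` the functional equation is used: the decay of `Γ(w)` cancels the growth of
  -- the cosine exactly and leaves a polynomial.
  · obtain ⟨w, rfl⟩ : ∃ w, s = 1 - w := ⟨1 - s, by ring⟩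
    simp only [Complex.sub_re, Complex.one_re, Complex.sub_im, Complex.one_im, zero_sub,
      abs_neg] at *
    have hre : |w.re| ≤ R := abs_le.mpr ⟨by linarith, by linarith [neg_abs_le a, abs_nonneg b]⟩
    have hw0 : ∀ n : ℕ, w ≠ -n := by
      rintro n rfl
      norm_num at h3
    have hw1 : w ≠ 1 := by
      rintro rfl
      norm_num at h3
    rw [riemannZeta_one_sub hw0 hw1]
    have e1 : ‖(2 * Real.pi : ℂ) ^ (-w)‖ ≤ 1 := by
      have : (2 * Real.pi : ℂ) = ((2 * Real.pi : ℝ) : ℂ) := by push_cast; rfl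
      rw [this, Complex.norm_cpow_eq_rpow_re_of_pos Real.two_pi_pos]
      refine Real.rpow_le_one_of_one_le_of_nonpos (by linarith [Real.pi_gt_three]) ?_
      simp
      linarith
    rw [norm_mul, norm_mul, norm_mul, norm_mul, Complex.norm_two]
    calc _ ≤ 2 * 1 * (B * ((1 + |w.im|) ^ N * Real.exp (-(Real.pi * |w.im| / 2)))) *
          Real.exp (Real.pi * |w.im| / 2) * (A * ((1 + R) * (1 + |w.im|))) := by
          gcongr
          · exact hG w (by linarith) (by linarith)
          · exact norm_cos_pi_mul_div_two_le w
          · refine (h w (by linarith) h3).trans ?_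
            gcongr
            exact hnorm w hre
      _ = 2 * B * (A * (1 + R)) * (1 + |w.im|) ^ (N + 1) := by
          rw [Real.exp_neg]
          field_simp
          ring
      _ ≤ _ := by
          have : 0 ≤ A * (1 + R) * (1 + |w.im|) ^ (N + 1) := by positivity
          linarith

/-! ### Residues through explicit principal parts -/

/-- The function `F` has a principal part at `p` with residue `r`. -/
def HasResidue (F : ℂ → ℂ) (p r : ℂ) : Prop :=
  ∃ (n : ℕ) (c : ℕ → ℂ) (g : ℂ → ℂ), AnalyticAt ℂ g p ∧ c 0 = r ∧
    ∀ᶠ w in nhdsWithin p {p}ᶜ, F w = g w + ∑ j ∈ Finset.range (n + 1), c j / (w - p) ^ (j + 1)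

lemma hasResidue_zero_of_eq_div_pow {F h : ℂ → ℂ} {n : ℕ} (hh : AnalyticAt ℂ h 0)
    (hF : ∀ᶠ w in nhdsWithin (0 : ℂ) {0}ᶜ, F w = h w / w ^ (n + 1)) :
    HasResidue F 0 (iteratedDeriv n h 0 / n.factorial) := by
  obtain ⟨g, hg, hgh⟩ := hh.exists_eq_sum_add_pow_mul (n + 1)
  refine ⟨n, fun j => iteratedDeriv (n - j) h 0 / (n - j).factorial, g, hg, by simp, ?_⟩
  filter_upwards [hF, self_mem_nhdsWithin] with w hw hw0
  have hw0 : w ≠ 0 := hw0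
  rw [hw, hgh w, ← Finset.sum_range_reflect, add_div, add_comm, Finset.sum_div]
  congr 1
  · simp [hw0]
  · refine Finset.sum_congr rfl fun j hj => ?_
    have hj' : j ≤ n := by
      have := Finset.mem_range.mp hj
      omega
    have e : n + 1 - 1 - j = n - j := by omega
    have e' : w ^ (n + 1) = w ^ (n - j) * w ^ (j + 1) := by
      rw [← pow_add]
      congr 1
      omega
    simp only [e, e', smul_eq_mul, sub_zero]
    field_simp

/-- Dividing the simple zero out by `dslope` leaves `h / (w - p)` with `h` analytic; a second
`dslope`, of `h`, is the regular part. -/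
lemma hasResidue_div_of_simple_zero {A D : ℂ → ℂ} {p : ℂ} (hA : AnalyticAt ℂ A p)
    (hD : Differentiable ℂ D) (hD0 : D p = 0) (hD1 : deriv D p ≠ 0) :
    HasResidue (fun w => A w / D w) p (A p / deriv D p) := by
  have hq : Differentiable ℂ (dslope D p) := by
    rw [← differentiableOn_univ] at hD ⊢
    exact (Complex.differentiableOn_dslope Filter.univ_mem).mpr hD
  have hqa : AnalyticAt ℂ (dslope D p) p := hq.analyticAt p
  have hqp : dslope D p p ≠ 0 := by rwa [dslope_same]
  set h : ℂ → ℂ := fun w => A w / dslope D p w with hh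
  have hha : AnalyticAt ℂ h p := hA.fun_div hqa hqp
  obtain ⟨ps, hps⟩ := hha
  refine ⟨0, fun _ => h p, dslope h p, ⟨_, hps.has_fpower_series_dslope_fslope⟩, ?_, ?_⟩
  · simp [hh]
  · filter_upwards [self_mem_nhdsWithin] with w hw
    have hw : w ≠ p := hw
    have hw' : w - p ≠ 0 := sub_ne_zero.mpr hw
    have e1 := sub_smul_dslope D p w
    have e2 := sub_smul_dslope h p w
    rw [hD0, sub_zero, smul_eq_mul] at e1
    rw [smul_eq_mul] at e2
    have e3 : dslope h p w = (h w - h p) / (w - p) := by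
      rw [← e2]
      field_simp
    have e4 : h w / (w - p) = A w / D w := by
      rw [← e1, hh, mul_comm, div_div]
    simp only [zero_add, Finset.sum_range_one, pow_one]
    rw [e3, ← e4]
    ring

/-- Reflection multiplies the coefficient of `(w - p)^(-(j+1))` by `(-1)^(j+1)` and antisymmetry by
another `-1`. At `j = 0` the signs cancel, so the residue is unchanged. -/
lemma HasResidue.reflect {F : ℂ → ℂ} {p r q : ℂ} (h : HasResidue F p r)
    (hF : ∀ w, F (q - w) = -F w) : HasResidue F (q - p) r := by
  obtain ⟨n, c, g, hg, hc, h⟩ := h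
  refine ⟨n, fun j => (-1) ^ j * c j, fun w => -g (q - w), ?_, by simpa using hc, ?_⟩
  · have e : q - (q - p) = p := by ring
    refine AnalyticAt.neg ?_
    refine AnalyticAt.fun_comp (by rwa [e]) (analyticAt_const.sub analyticAt_id)
  · have ht : Filter.Tendsto (fun w => q - w) (nhdsWithin (q - p) {q - p}ᶜ)
        (nhdsWithin p {p}ᶜ) := by
      refine tendsto_nhdsWithin_iff.mpr ⟨?_, ?_⟩
      · have : Filter.Tendsto (fun w => q - w) (nhds (q - p)) (nhds (q - (q - p))) :=
          (continuous_const.sub continuous_id).tendsto _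
        rw [sub_sub_cancel] at this
        exact this.mono_left nhdsWithin_le_nhds
      · filter_upwards [self_mem_nhdsWithin] with w hw h'
        apply hw
        have h' : q - w = p := h'
        rw [Set.mem_singleton_iff, ← h']
        ring
    filter_upwards [ht.eventually h] with w hw
    have := hF w
    rw [hw] at this
    rw [← neg_eq_iff_eq_neg.mpr this, neg_add, ← Finset.sum_neg_distrib]
    congr 1
    refine Finset.sum_congr rfl fun j _ => ?_
    have e : q - w - p = -(w - (q - p)) := by ring
    rw [e, neg_pow (w - (q - p)), pow_succ (-1 : ℂ) j]
    generalize (w - (q - p)) ^ (j + 1) = X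
    rcases neg_one_pow_eq_or ℂ j with h' | h' <;> rw [h'] <;> simp [div_neg, neg_div]

/-! ### Residue theorem for a vertical strip -/

lemma ofReal_add_mul_I_ne_zero {x : ℝ} (hx : x ≠ 0) (y : ℝ) : (x + y * Complex.I : ℂ) ≠ 0 := by
  intro h
  have := congrArg Complex.re h
  simp at this
  exact hx this

lemma hasDerivAt_ofReal_add_mul_I (x y : ℝ) :
    HasDerivAt (fun y : ℝ => (x + y * Complex.I : ℂ)) Complex.I y := by
  have := ((Complex.ofRealCLM.hasDerivAt (x := y)).mul_const Complex.I).const_add (x : ℂ)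
  simpa using this

/-- The primitive is split into `arctan` and a real logarithm, which avoids branch cuts; the
logarithm is even in `y` and cancels over `[-T, T]`. -/
lemma integral_inv_vertical {x : ℝ} (hx : x ≠ 0) (T : ℝ) :
    ∫ y in -T..T, 1 / (x + y * Complex.I : ℂ) = ((2 * Real.arctan (T / x) : ℝ) : ℂ) := by
  have hd : ∀ y : ℝ, HasDerivAt (fun y : ℝ => ((Real.arctan (y / x) : ℝ) : ℂ) -
      Complex.I / 2 * ((Real.log (x ^ 2 + y ^ 2) : ℝ) : ℂ)) (1 / (x + y * Complex.I : ℂ)) y := by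
    intro y
    have hpos : x ^ 2 + y ^ 2 ≠ 0 := by positivity
    have h1 := ((hasDerivAt_id y).div_const x).arctan.ofReal_comp
    have h2 := ((hasDerivAt_pow 2 y).const_add (x ^ 2)).log hpos |>.ofReal_comp
    have h3 := h1.sub (h2.const_mul (Complex.I / 2))
    refine h3.congr_deriv ?_
    have hne := ofReal_add_mul_I_ne_zero hx y
    have hpos' : (x : ℂ) ^ 2 + (y : ℂ) ^ 2 ≠ 0 := by exact_mod_cast hpos
    have hx' : (x : ℂ) ≠ 0 := by exact_mod_cast hx
    have e : (x : ℂ) ^ 2 + (y : ℂ) ^ 2 = (x + y * Complex.I) * (x - y * Complex.I) := by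
      ring_nf
      rw [Complex.I_sq]
      ring
    have e1 : (1 + ((y / x : ℝ) : ℂ) ^ 2) = ((x : ℂ) ^ 2 + (y : ℂ) ^ 2) / (x : ℂ) ^ 2 := by
      push_cast
      field_simp
    have hne2 : (x - y * Complex.I : ℂ) ≠ 0 := by
      intro h
      rw [e, h, mul_zero] at hpos'
      exact hpos' rfl
    push_cast at e1 ⊢
    simp only [id_eq]
    rw [e1, e]
    field_simp
  rw [intervalIntegral.integral_eq_sub_of_hasDerivAt (fun y _ => hd y)]
  · rw [neg_div, Real.arctan_neg, neg_sq]
    push_cast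
    ring
  · refine Continuous.intervalIntegrable ?_ _ _
    exact continuous_const.div (by fun_prop) (ofReal_add_mul_I_ne_zero hx)

lemma integral_inv_pow_vertical {x : ℝ} (hx : x ≠ 0) (j : ℕ) (T : ℝ) :
    ∫ y in -T..T, 1 / (x + y * Complex.I : ℂ) ^ (j + 2) =
      Complex.I / (j + 1) * (1 / (x + T * Complex.I) ^ (j + 1) -
        1 / (x - T * Complex.I) ^ (j + 1)) := by
  have hj : (j + 1 : ℂ) ≠ 0 := by exact_mod_cast j.succ_ne_zero
  have hd : ∀ y : ℝ, HasDerivAt (fun y : ℝ => Complex.I / (j + 1) *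
      (1 / (x + y * Complex.I : ℂ) ^ (j + 1))) (1 / (x + y * Complex.I : ℂ) ^ (j + 2)) y := by
    intro y
    have hne := ofReal_add_mul_I_ne_zero hx y
    have h1 := (((hasDerivAt_ofReal_add_mul_I x y).fun_pow (j + 1)).fun_inv
      (pow_ne_zero _ hne)).const_mul (Complex.I / (j + 1))
    simp only [one_div]
    refine h1.congr_deriv ?_
    generalize (x + y * Complex.I : ℂ) = z at hne ⊢
    have e : (z ^ (j + 1)) ^ 2 = z ^ j * z ^ (j + 2) := by ring
    have hz : z ^ j ≠ 0 := pow_ne_zero _ hne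
    push_cast
    rw [e]
    field_simp
    rw [Complex.I_sq]
    ring
  rw [intervalIntegral.integral_eq_sub_of_hasDerivAt (fun y _ => hd y)]
  · push_cast
    rw [neg_mul, ← sub_eq_add_neg]
    ring
  · refine Continuous.intervalIntegrable ?_ _ _
    exact continuous_const.div (by fun_prop) fun y => pow_ne_zero _ (ofReal_add_mul_I_ne_zero hx y)

lemma abs_le_norm_ofReal_add_mul_I (x y : ℝ) : |y| ≤ ‖(x + y * Complex.I : ℂ)‖ := by
  simpa using Complex.abs_im_le_norm (x + y * Complex.I : ℂ)

lemma tendsto_integral_inv_pow_vertical {x : ℝ} (hx : x ≠ 0) (j : ℕ) :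
    Filter.Tendsto (fun T : ℝ => ∫ y in -T..T, 1 / (x + y * Complex.I : ℂ) ^ (j + 2))
      Filter.atTop (nhds 0) := by
  simp_rw [integral_inv_pow_vertical hx]
  have hsq : ∀ ε : ℝ, |ε| = 1 → Filter.Tendsto
      (fun T : ℝ => 1 / (x + (ε * T : ℝ) * Complex.I : ℂ) ^ (j + 1)) Filter.atTop (nhds 0) := by
    intro ε hε
    refine squeeze_zero_norm' (a := fun T : ℝ => T⁻¹) ?_ tendsto_inv_atTop_zero
    filter_upwards [Filter.eventually_ge_atTop 1] with T hT
    have h1 : T ≤ ‖(x + (ε * T : ℝ) * Complex.I : ℂ)‖ := by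
      refine le_trans ?_ (abs_le_norm_ofReal_add_mul_I _ _)
      rw [abs_mul, hε, one_mul]
      exact le_abs_self T
    rw [norm_div, norm_one, norm_pow, one_div]
    refine inv_anti₀ (by linarith) (h1.trans ?_)
    exact le_self_pow₀ (hT.trans h1) (by omega)
  have h := ((hsq 1 (by simp)).sub (hsq (-1) (by simp))).const_mul (Complex.I / (j + 1))
  simpa [← sub_eq_add_neg] using h

lemma tendsto_integral_inv_vertical_of_pos {x : ℝ} (hx : 0 < x) :
    Filter.Tendsto (fun T : ℝ => ∫ y in -T..T, 1 / (x + y * Complex.I : ℂ))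
      Filter.atTop (nhds (Real.pi : ℂ)) := by
  simp_rw [integral_inv_vertical hx.ne']
  refine (Complex.continuous_ofReal.tendsto _).comp ?_
  have h := ((Real.tendsto_arctan_atTop.mono_right nhdsWithin_le_nhds).comp
    (Filter.tendsto_id.atTop_div_const hx)).const_mul 2
  have e : 2 * (Real.pi / 2) = Real.pi := by ring
  rw [e] at h
  exact h

lemma tendsto_integral_inv_vertical_of_neg {x : ℝ} (hx : x < 0) :
    Filter.Tendsto (fun T : ℝ => ∫ y in -T..T, 1 / (x + y * Complex.I : ℂ))
      Filter.atTop (nhds (-Real.pi : ℂ)) := by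
  have h := (tendsto_integral_inv_vertical_of_pos (neg_pos.mpr hx)).neg
  refine h.congr fun T => ?_
  rw [integral_inv_vertical hx.ne, integral_inv_vertical (neg_pos.mpr hx).ne', div_neg,
    Real.arctan_neg]
  push_cast
  ring

/-- Poles of order at least two contribute nothing in the limit. The simple pole contributes `π` on
the line to its right and `-π` on the line to its left. -/
lemma tendsto_integral_principalPart {a b p : ℝ} (ha : a < p) (hb : p < b) (n : ℕ) (c : ℕ → ℂ) :
    Filter.Tendsto (fun T : ℝ =>
      (∫ y in -T..T, ∑ j ∈ Finset.range (n + 1), c j / (b + y * Complex.I - p : ℂ) ^ (j + 1)) -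
      ∫ y in -T..T, ∑ j ∈ Finset.range (n + 1), c j / (a + y * Complex.I - p : ℂ) ^ (j + 1))
      Filter.atTop (nhds (2 * Real.pi * c 0)) := by
  have hcont : ∀ x : ℝ, x ≠ p → ∀ j : ℕ,
      Continuous fun y : ℝ => c j / (x + y * Complex.I - p : ℂ) ^ (j + 1) := by
    intro x hx j
    refine continuous_const.div (by fun_prop) fun y => pow_ne_zero _ ?_
    have := ofReal_add_mul_I_ne_zero (sub_ne_zero.mpr hx) y
    push_cast at this
    intro h
    apply this
    rw [← h]
    ring
  have hsplit : ∀ x : ℝ, x ≠ p → ∀ T : ℝ,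
      ∫ y in -T..T, ∑ j ∈ Finset.range (n + 1), c j / (x + y * Complex.I - p : ℂ) ^ (j + 1) =
      ∑ j ∈ Finset.range (n + 1), c j *
        ∫ y in -T..T, 1 / ((x - p : ℝ) + y * Complex.I : ℂ) ^ (j + 1) := by
    intro x hx T
    rw [intervalIntegral.integral_finsetSum
      (fun j _ => (hcont x hx j).intervalIntegrable _ _)]
    refine Finset.sum_congr rfl fun j _ => ?_
    rw [← intervalIntegral.integral_const_mul]
    congr 1
    funext y
    rw [mul_one_div]
    congr 2
    push_cast
    ring
  simp_rw [hsplit b hb.ne', hsplit a ha.ne, Finset.sum_range_succ', zero_add, pow_one]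
  have h1 : ∀ x : ℝ, x ≠ p → Filter.Tendsto (fun T : ℝ => ∑ j ∈ Finset.range n, c (j + 1) *
      ∫ y in -T..T, 1 / ((x - p : ℝ) + y * Complex.I : ℂ) ^ (j + 1 + 1)) Filter.atTop
      (nhds (∑ j ∈ Finset.range n, c (j + 1) * 0)) := by
    intro x hx
    exact tendsto_finsetSum _ fun j _ =>
      (tendsto_integral_inv_pow_vertical (sub_ne_zero.mpr hx) j).const_mul _
  have h2 := (tendsto_integral_inv_vertical_of_pos (sub_pos.mpr hb)).const_mul (c 0)
  have h3 := (tendsto_integral_inv_vertical_of_neg (sub_neg.mpr ha)).const_mul (c 0)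
  have h4 := ((h1 b hb.ne').add h2).sub ((h1 a ha.ne).add h3)
  convert h4 using 2
  ring

lemma norm_principalPart_le (n : ℕ) (c : ℕ → ℂ) (p : ℝ) {w : ℂ} (hw : 1 ≤ |w.im|) :
    ‖∑ j ∈ Finset.range (n + 1), c j / (w - p) ^ (j + 1)‖ ≤
      (∑ j ∈ Finset.range (n + 1), ‖c j‖) * |w.im|⁻¹ := by
  rw [Finset.sum_mul]
  refine norm_sum_le_of_le _ fun j _ => ?_
  rw [norm_div, norm_pow, div_eq_mul_inv]
  refine mul_le_mul_of_nonneg_left (inv_anti₀ (by linarith) ?_) (norm_nonneg _)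
  have h1 : |w.im| ≤ ‖w - p‖ := by simpa using Complex.abs_im_le_norm (w - p)
  exact h1.trans (le_self_pow₀ (hw.trans h1) (by omega))

lemma intervalIntegrable_vertical {F : ℂ → ℂ} {x : ℝ}
    (hF : ∀ w : ℂ, w.re = x → DifferentiableAt ℂ F w) (T T' : ℝ) :
    IntervalIntegrable (fun y : ℝ => F (x + y * Complex.I)) MeasureTheory.volume T T' := by
  refine Continuous.intervalIntegrable ?_ _ _
  refine continuous_iff_continuousAt.mpr fun y => ?_
  exact ContinuousAt.comp (f := fun y : ℝ => (x + y * Complex.I : ℂ))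
    (hF _ (by simp)).continuousAt (by fun_prop)

lemma tendsto_integral_vertical_sub_of_differentiableAt {F : ℂ → ℂ} {a b : ℝ} (hab : a < b)
    (hF : ∀ w : ℂ, a ≤ w.re → w.re ≤ b → DifferentiableAt ℂ F w)
    {β : ℝ → ℝ} (hβ : Filter.Tendsto β Filter.atTop (nhds 0))
    (hFβ : ∀ w : ℂ, a ≤ w.re → w.re ≤ b → 1 ≤ |w.im| → ‖F w‖ ≤ β |w.im|) :
    Filter.Tendsto (fun T : ℝ => (∫ y in -T..T, F (b + y * Complex.I)) -
      ∫ y in -T..T, F (a + y * Complex.I)) Filter.atTop (nhds 0) := by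
  refine squeeze_zero_norm' (a := fun T => 2 * (b - a) * β T) ?_ (by simpa using hβ.const_mul _)
  filter_upwards [Filter.eventually_ge_atTop 1] with T hT
  have h := Complex.integral_boundary_rect_eq_zero_of_differentiableOn F
    (a - T * Complex.I) (b + T * Complex.I) (fun w hw => by
      have := hw.1
      simp [Set.uIcc_of_le hab.le] at this
      exact (hF w this.1 this.2).differentiableWithinAt)
  simp only [Complex.sub_re, Complex.ofReal_re, Complex.mul_re, Complex.I_re, mul_zero,
    Complex.ofReal_im, Complex.I_im, mul_one, sub_self, sub_zero, Complex.add_re, add_zero,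
    Complex.sub_im, Complex.mul_im, zero_sub, Complex.add_im, zero_add, smul_eq_mul] at h
  have hI : ∀ ε : ℝ, |ε| = T → ‖∫ x in a..b, F (x + ε * Complex.I)‖ ≤ β T * |b - a| := by
    intro ε hε
    refine intervalIntegral.norm_integral_le_of_norm_le_const fun x hx => ?_
    rw [Set.uIoc_of_le hab.le] at hx
    have := hFβ (x + ε * Complex.I) (by simpa using hx.1.le) (by simpa using hx.2)
      (by simpa [hε] using hT)
    simpa [hε] using this
  have h1 := hI (-T) (by rw [abs_neg, abs_of_nonneg (by linarith)])
  have h2 := hI T (abs_of_nonneg (by linarith))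
  have e : (∫ y in -T..T, F (b + y * Complex.I)) - ∫ y in -T..T, F (a + y * Complex.I) =
      Complex.I * ((∫ x in a..b, F (x + (-T : ℝ) * Complex.I)) -
        ∫ x in a..b, F (x + T * Complex.I)) := by
    linear_combination (-Complex.I) * h + (-(∫ y in -T..T, F (b + y * Complex.I)) +
      ∫ y in -T..T, F (a + y * Complex.I)) * (-Complex.I_mul_I)
  rw [e, norm_mul, Complex.norm_I, one_mul]
  rw [abs_of_pos (sub_pos.mpr hab)] at h1 h2
  refine (norm_sub_le _ _).trans ?_
  linarith

/-- The residue theorem for a vertical strip with real poles, with symmetric limits. -/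
theorem tendsto_integral_vertical_sub {a b : ℝ} (hab : a < b) (S : Finset ℝ) (r : ℝ → ℂ)
    (hS : ∀ p ∈ S, a < p ∧ p < b) (F : ℂ → ℂ)
    (hF : ∀ w : ℂ, a ≤ w.re → w.re ≤ b → (∀ p ∈ S, w ≠ (p : ℂ)) → DifferentiableAt ℂ F w)
    (hres : ∀ p ∈ S, HasResidue F p (r p))
    {β : ℝ → ℝ} (hβ : Filter.Tendsto β Filter.atTop (nhds 0))
    (hFβ : ∀ w : ℂ, a ≤ w.re → w.re ≤ b → 1 ≤ |w.im| → ‖F w‖ ≤ β |w.im|) :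
    Filter.Tendsto (fun T : ℝ => (∫ y in -T..T, F (b + y * Complex.I)) -
      ∫ y in -T..T, F (a + y * Complex.I)) Filter.atTop
      (nhds (2 * Real.pi * ∑ p ∈ S, r p)) := by
  -- Each step subtracts one principal part. The remainder may decay only like `1/T`, which is why
  -- `β` is an arbitrary function tending to `0` and is generalized.
  induction S using Finset.induction_on generalizing F β with
  | empty =>
    simpa using tendsto_integral_vertical_sub_of_differentiableAt hab
      (fun w h1 h2 => hF w h1 h2 (by simp)) hβ hFβ
  | insert p S hp ih =>
    obtain ⟨hap, hpb⟩ := hS p (Finset.mem_insert_self _ _)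
    obtain ⟨n, c, g, hg, hc, hFg⟩ := hres p (Finset.mem_insert_self _ _)
    set P : ℂ → ℂ := fun w => ∑ j ∈ Finset.range (n + 1), c j / (w - p) ^ (j + 1) with hP
    have hPa : ∀ w : ℂ, w ≠ p → AnalyticAt ℂ P w := by
      intro w hw
      refine Finset.analyticAt_fun_sum _ fun j _ => ?_
      exact analyticAt_const.fun_div (by fun_prop) (pow_ne_zero _ (sub_ne_zero.mpr hw))
    -- The value at `p` is corrected so that the removable singularity is really removed.
    set G : ℂ → ℂ := Function.update (fun w => F w - P w) (p : ℂ) (g p) with hG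
    have hGne : ∀ w : ℂ, w ≠ p → G w = F w - P w := fun w hw => by
      rw [hG, Function.update_of_ne hw]
    have hGev : ∀ w : ℂ, w ≠ p → G =ᶠ[nhds w] fun w => F w - P w := fun w hw => by
      filter_upwards [isOpen_ne.mem_nhds hw] with z hz
      exact hGne z hz
    have hGp : G =ᶠ[nhds (p : ℂ)] g := by
      rw [Filter.EventuallyEq, ← nhdsNE_sup_pure, Filter.eventually_sup]
      refine ⟨?_, by simp [hG]⟩
      filter_upwards [hFg, self_mem_nhdsWithin] with w hw hwp
      rw [hGne w hwp, hw]
      simp [hP]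
    have hFd : ∀ w : ℂ, a ≤ w.re → w.re ≤ b → w ≠ p → (∀ q ∈ S, w ≠ (q : ℂ)) →
        DifferentiableAt ℂ F w := by
      intro w h1 h2 h3 h4
      refine hF w h1 h2 fun q hq => ?_
      rcases Finset.mem_insert.mp hq with rfl | hq
      · exact h3
      · exact h4 q hq
    have hGd : ∀ w : ℂ, a ≤ w.re → w.re ≤ b → (∀ q ∈ S, w ≠ (q : ℂ)) →
        DifferentiableAt ℂ G w := by
      intro w h1 h2 h3
      by_cases hw : w = p
      · rw [hw]
        exact hg.differentiableAt.congr_of_eventuallyEq hGp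
      · exact ((hFd w h1 h2 hw h3).sub (hPa w hw).differentiableAt).congr_of_eventuallyEq
          (hGev w hw)
    have hGres : ∀ q ∈ S, HasResidue G q (r q) := by
      intro q hq
      have hqp : (q : ℂ) ≠ p := by
        intro h
        have : q = p := by exact_mod_cast h
        exact hp (this ▸ hq)
      obtain ⟨n', c', g', hg', hc', hFg'⟩ := hres q (Finset.mem_insert_of_mem hq)
      refine ⟨n', c', fun w => g' w - P w, hg'.sub (hPa q hqp), hc', ?_⟩
      filter_upwards [hFg', (hGev q hqp).filter_mono nhdsWithin_le_nhds] with w h1 h2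
      rw [h2, h1]
      ring
    have hGβ : ∀ w : ℂ, a ≤ w.re → w.re ≤ b → 1 ≤ |w.im| →
        ‖G w‖ ≤ β |w.im| + (∑ j ∈ Finset.range (n + 1), ‖c j‖) * |w.im|⁻¹ := by
      intro w h1 h2 h3
      have hw : w ≠ p := by
        rintro rfl
        norm_num at h3
      rw [hGne w hw]
      exact (norm_sub_le _ _).trans (add_le_add (hFβ w h1 h2 h3) (norm_principalPart_le n c p h3))
    have hlim := ih (fun q hq => hS q (Finset.mem_insert_of_mem hq)) G hGd hGres
      (β := fun T => β T + (∑ j ∈ Finset.range (n + 1), ‖c j‖) * T⁻¹)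
      (by simpa using hβ.add (tendsto_inv_atTop_zero.const_mul
        (∑ j ∈ Finset.range (n + 1), ‖c j‖))) hGβ
    have hPlim := tendsto_integral_principalPart hap hpb n c
    rw [Finset.sum_insert hp, ← hc, mul_add, add_comm]
    refine (hlim.add hPlim).congr fun T => ?_
    have hline : ∀ x : ℝ, a ≤ x → x ≤ b → x ≠ p → (∀ q ∈ S, x ≠ q) →
        ∫ y in -T..T, F (x + y * Complex.I) = (∫ y in -T..T, G (x + y * Complex.I)) +
          ∫ y in -T..T, P (x + y * Complex.I) := by
      intro x h1 h2 h3 h4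
      have hne : ∀ w : ℂ, w.re = x → ∀ q : ℝ, x ≠ q → w ≠ q := by
        rintro w hw q hq rfl
        exact hq (by simpa using hw.symm)
      rw [← intervalIntegral.integral_add
        (intervalIntegrable_vertical (fun w hw => hGd w (hw ▸ h1) (hw ▸ h2)
          fun q hq => hne w hw q (h4 q hq)) _ _)
        (intervalIntegrable_vertical (fun w hw => (hPa w (hne w hw p h3)).differentiableAt) _ _)]
      congr 1
      funext y
      rw [hGne _ (hne _ (by simp) p h3)]
      ring
    rw [hline b hab.le le_rfl hpb.ne' (fun q hq => (hS q (Finset.mem_insert_of_mem hq)).2.ne'),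
      hline a le_rfl hab.le hap.ne (fun q hq => (hS q (Finset.mem_insert_of_mem hq)).1.ne)]
    simp only [hP]
    ring

/-! ### Dirichlet series of the Piltz function -/

lemma piltz_zero (n : ℕ) : piltz 0 n = if n = 1 then 1 else 0 := by
  split_ifs with h
  · subst h
    rw [piltz, Finset.card_eq_one]
    refine ⟨Fin.elim0, Finset.eq_singleton_iff_unique_mem.mpr ⟨?_, fun f _ => ?_⟩⟩
    · simp [Nat.mem_finMulAntidiag]
    · exact Subsingleton.elim _ _
  · rw [piltz, Nat.finMulAntidiag_zero_left h, Finset.card_empty]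

lemma piltz_succ (k n : ℕ) :
    piltz (k + 1) n = ∑ x ∈ n.divisorsAntidiagonal, piltz k x.2 := by
  simp only [piltz]
  rw [← Finset.card_sigma]
  refine Finset.card_bij' (fun f _ => ⟨(f 0, ∏ i : Fin k, f i.succ), fun i => f i.succ⟩)
    (fun x _ => Fin.cons x.1.1 x.2) ?_ ?_ ?_ ?_
  · intro f hf
    rw [Nat.mem_finMulAntidiag, Fin.prod_univ_succ] at hf
    rw [Finset.mem_sigma, Nat.mem_divisorsAntidiagonal, Nat.mem_finMulAntidiag]
    exact ⟨hf, rfl, fun h => hf.2 (by rw [← hf.1]; exact mul_eq_zero_of_right _ h)⟩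
  · rintro ⟨⟨a, b⟩, g⟩ hx
    rw [Finset.mem_sigma, Nat.mem_divisorsAntidiagonal, Nat.mem_finMulAntidiag] at hx
    rw [Nat.mem_finMulAntidiag, Fin.prod_univ_succ]
    simp only [Fin.cons_zero, Fin.cons_succ]
    exact ⟨by rw [hx.2.1]; exact hx.1.1, hx.1.2⟩
  · intro f _
    exact Fin.cons_self_tail f
  · rintro ⟨⟨a, b⟩, g⟩ hx
    rw [Finset.mem_sigma, Nat.mem_finMulAntidiag] at hx
    have h : ∏ i, g i = b := hx.2.1
    simp [h]

/-- Splitting off the first entry of a tuple shows that `d_k` is the `k`-fold Dirichlet convolution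
of the constant `1`; hence its series is `ζ^k`. -/
lemma natCast_zeta_pow_apply (k : ℕ) {n : ℕ} (hn : n ≠ 0) :
    ((ArithmeticFunction.zeta : ArithmeticFunction ℂ) ^ k) n = (piltz k n : ℂ) := by
  induction k generalizing n with
  | zero =>
    rw [pow_zero, piltz_zero, ArithmeticFunction.one_apply]
    push_cast
    rfl
  | succ k ih =>
    rw [pow_succ', ArithmeticFunction.mul_apply, piltz_succ]
    push_cast
    refine Finset.sum_congr rfl fun x hx => ?_
    have h := Nat.mem_divisorsAntidiagonal.mp hx
    have h1 : x.1 ≠ 0 := fun h0 => h.2 (by rw [← h.1, h0, zero_mul])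
    have h2 : x.2 ≠ 0 := fun h0 => h.2 (by rw [← h.1, h0, mul_zero])
    rw [ih h2, ArithmeticFunction.natCoe_apply, ArithmeticFunction.zeta_apply_ne h1, Nat.cast_one,
      one_mul]

lemma piltz_one {n : ℕ} (hn : n ≠ 0) : piltz 1 n = 1 := by
  have := natCast_zeta_pow_apply 1 hn
  rw [pow_one, ArithmeticFunction.natCoe_apply, ArithmeticFunction.zeta_apply_ne hn] at this
  exact_mod_cast this.symm

lemma LSeriesHasSum_zeta_pow (k : ℕ) {s : ℂ} (hs : 1 < s.re) :
    LSeriesHasSum (fun n => ((ArithmeticFunction.zeta : ArithmeticFunction ℂ) ^ k) n) s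
      (riemannZeta s ^ k) := by
  induction k with
  | zero =>
    simp only [pow_zero]
    rw [ArithmeticFunction.one_eq_delta]
    unfold LSeriesHasSum
    simp_rw [funext (LSeries.term_delta s)]
    exact hasSum_ite_eq 1 1
  | succ k ih =>
    rw [pow_succ, pow_succ]
    exact ArithmeticFunction.LSeriesHasSum_mul ih (ArithmeticFunction.LSeriesHasSum_zeta hs)

lemma hasSum_piltz_mul_cpow (k : ℕ) {s : ℂ} (hs : 1 < s.re) :
    HasSum (fun n : ℕ+ => (piltz k n : ℂ) * (n : ℂ) ^ (-s)) (riemannZeta s ^ k) := by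
  have h := LSeriesHasSum_zeta_pow k hs
  unfold LSeriesHasSum at h
  rw [← PNat.coe_injective.hasSum_iff] at h
  · convert h using 2 with n
    rw [Function.comp_apply, LSeries.term_of_ne_zero n.ne_zero, natCast_zeta_pow_apply k n.ne_zero,
      Complex.cpow_neg, div_eq_mul_inv]
  · intro n hn
    have : n = 0 := by
      by_contra h0
      exact hn ⟨⟨n, Nat.pos_of_ne_zero h0⟩, rfl⟩
    rw [this, LSeries.term_zero]

lemma norm_natCast_cpow (n : ℕ+) (s : ℂ) : ‖(n : ℂ) ^ s‖ = (n : ℝ) ^ s.re :=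
  Complex.norm_natCast_cpow_of_pos n.pos s

lemma summable_piltz_mul_rpow (k : ℕ) {σ : ℝ} (hσ : 1 < σ) :
    Summable (fun n : ℕ+ => (piltz k n : ℝ) * (n : ℝ) ^ (-σ)) := by
  have h := (hasSum_piltz_mul_cpow k (s := σ) (by simpa using hσ)).summable.norm
  refine h.congr fun n => ?_
  rw [norm_mul, norm_natCast_cpow, Complex.norm_natCast]
  simp

/-! ### The Meijer function as an inverse Mellin transform -/

lemma meijerIntegrand_psiParam {k : ℕ} (hk : 1 ≤ k) (z s : ℂ) :
    meijerIntegrand (k + 1) 0 (Fin.elim0 : Fin 0 → ℂ) (psiParam k) z s =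
      Complex.Gamma (-s) ^ k * Complex.Gamma (1 / 2 - s) /
        Complex.Gamma (1 / 2 + s) ^ (k - 1) * z ^ s := by
  obtain ⟨l, rfl⟩ : ∃ l, k = l + 1 := ⟨k - 1, by omega⟩
  have h1 : (∏ j : Fin (2 * (l + 1)) with j.val < l + 1 + 1,
      Complex.Gamma (psiParam (l + 1) j - s)) =
        Complex.Gamma (-s) ^ (l + 1) * Complex.Gamma (1 / 2 - s) := by
    rw [Finset.prod_filter]
    simp only [psiParam]
    rw [Fin.prod_univ_eq_prod_range (fun i => if i < l + 1 + 1 then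
      Complex.Gamma ((if i < l + 1 then 0 else 1 / 2) - s) else 1) (2 * (l + 1)),
      -- The indices split into `l + 1` zeros, the one half that belongs to the numerator, and the
      -- `l` halves of the denominator.
      show 2 * (l + 1) = l + 1 + 1 + l by ring, Finset.prod_range_add, Finset.prod_range_succ]
    have e1 : ∏ x ∈ Finset.range (l + 1), (if x < l + 1 + 1 then
        Complex.Gamma ((if x < l + 1 then 0 else 1 / 2) - s) else 1) =
        ∏ x ∈ Finset.range (l + 1), Complex.Gamma (-s) := by
      refine Finset.prod_congr rfl fun x hx => ?_
      have hx' := Finset.mem_range.mp hx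
      rw [if_pos (by omega), if_pos hx', zero_sub]
    have e2 : ∏ x ∈ Finset.range l, (if l + 1 + 1 + x < l + 1 + 1 then
        Complex.Gamma ((if l + 1 + 1 + x < l + 1 then 0 else 1 / 2) - s) else 1) = 1 := by
      refine Finset.prod_eq_one fun x _ => ?_
      rw [if_neg (by omega)]
    rw [e1, e2]
    simp
  have h2 : (∏ j : Fin (2 * (l + 1)) with l + 1 + 1 ≤ j.val,
      Complex.Gamma (1 - psiParam (l + 1) j + s)) = Complex.Gamma (1 / 2 + s) ^ l := by
    rw [Finset.prod_filter]
    simp only [psiParam]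
    rw [Fin.prod_univ_eq_prod_range (fun i => if l + 1 + 1 ≤ i then
      Complex.Gamma (1 - (if i < l + 1 then 0 else 1 / 2) + s) else 1) (2 * (l + 1)),
      show 2 * (l + 1) = l + 1 + 1 + l by ring, Finset.prod_range_add]
    have e1 : ∏ x ∈ Finset.range (l + 1 + 1), (if l + 1 + 1 ≤ x then
        Complex.Gamma (1 - (if x < l + 1 then 0 else 1 / 2) + s) else 1) = 1 := by
      refine Finset.prod_eq_one fun x hx => ?_
      have hx' := Finset.mem_range.mp hx
      rw [if_neg (by omega)]
    have e2 : ∏ x ∈ Finset.range l, (if l + 1 + 1 ≤ l + 1 + 1 + x then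
        Complex.Gamma (1 - (if l + 1 + 1 + x < l + 1 then 0 else 1 / 2) + s) else 1) =
        ∏ x ∈ Finset.range l, Complex.Gamma (1 / 2 + s) := by
      refine Finset.prod_congr rfl fun x _ => ?_
      rw [if_pos (by omega), if_neg (by omega)]
      norm_num
    rw [e1, e2]
    simp
  rw [meijerIntegrand, h1, h2]
  simp

/-- The factor in front of the series `Ψ_{ρ,k}`. -/
def psiFactor (k : ℕ) : ℂ := ((Real.pi ^ ((k : ℝ) / 2 - 1) / 2 ^ (k - 1) : ℝ) : ℂ)

lemma psiFactor_ne_zero (k : ℕ) : psiFactor k ≠ 0 := by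
  rw [psiFactor, Complex.ofReal_ne_zero]
  have := Real.pi_pos
  positivity

lemma psiFactor_mul_sqrt_pi_pow {k : ℕ} (hk : 1 ≤ k) :
    psiFactor k * 2 ^ k * ((√Real.pi : ℝ) : ℂ) ^ k = 2 * (Real.pi : ℂ) ^ (k - 1) := by
  obtain ⟨l, rfl⟩ : ∃ l, k = l + 1 := ⟨k - 1, by omega⟩
  have h : Real.pi ^ (((l + 1 : ℕ) : ℝ) / 2 - 1) = √Real.pi ^ (l + 1) / Real.pi := by
    rw [Real.rpow_sub_one Real.pi_ne_zero, Real.sqrt_eq_rpow, ← Real.rpow_natCast,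
      ← Real.rpow_mul Real.pi_pos.le]
    congr 2
    ring
  rw [psiFactor, h, Nat.add_sub_cancel]
  norm_cast
  have hs : √Real.pi ^ (l + 1) * √Real.pi ^ (l + 1) = Real.pi ^ (l + 1) := by
    rw [← mul_pow, Real.mul_self_sqrt Real.pi_pos.le]
  have := Real.pi_ne_zero
  field_simp
  rw [sq, hs]
  push_cast
  ring

/-- The reflection formula. No condition on the cosine is needed: where it vanishes, `Γ(1/2 - w/2)`
is at a pole, where its assigned value is `0`, and both sides are `0`. -/
lemma inv_Gamma_one_sub_div_two {w : ℂ} (hw : 0 < w.re) :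
    (Complex.Gamma (1 / 2 - w / 2))⁻¹ =
      Complex.cos (Real.pi * w / 2) * Complex.Gamma (w / 2 + 1 / 2) / Real.pi := by
  have h := Complex.Gamma_mul_Gamma_one_sub (w / 2 + 1 / 2)
  have e1 : 1 - (w / 2 + 1 / 2) = 1 / 2 - w / 2 := by ring
  have e2 : Complex.sin (Real.pi * (w / 2 + 1 / 2)) = Complex.cos (Real.pi * w / 2) := by
    rw [← Complex.sin_add_pi_div_two]
    congr 1
    ring
  rw [e1, e2] at h
  have hne : Complex.Gamma (w / 2 + 1 / 2) ≠ 0 := by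
    refine Complex.Gamma_ne_zero_of_re_pos ?_
    simp
    linarith
  have h' : Complex.Gamma (1 / 2 - w / 2) =
      Real.pi / Complex.cos (Real.pi * w / 2) / Complex.Gamma (w / 2 + 1 / 2) := by
    rw [← h, mul_div_cancel_left₀ _ hne]
  rw [h', inv_div, div_div_eq_mul_div, mul_comm]

/-- Reflection moves the `k - 1` Gamma factors of the denominator upstairs at the cost of cosines.
This leaves `(Γ(w/2) Γ(w/2 + 1/2))^k`, which duplication turns into `Γ(w)^k`; the powers of `2` go
into `Y^(-w)`, and those of `π` are absorbed by `psiFactor`. -/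
lemma psiFactor_mul_meijerIntegrand {k : ℕ} (hk : 1 ≤ k) {Y : ℝ} (hY : 0 < Y) {w : ℂ}
    (hw : 0 < w.re) :
    psiFactor k * meijerIntegrand (k + 1) 0 (Fin.elim0 : Fin 0 → ℂ) (psiParam k)
      ((Y ^ 2 / 2 ^ (2 * k) : ℝ) : ℂ) (-w / 2) = 2 * (psiKernel k w * (Y : ℂ) ^ (-w)) := by
  obtain ⟨l, rfl⟩ : ∃ l, k = l + 1 := ⟨k - 1, by omega⟩
  have hpi : (Real.pi : ℂ) ≠ 0 := by exact_mod_cast Real.pi_ne_zero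
  have hdup := Complex.Gamma_mul_Gamma_add_half (w / 2)
  rw [mul_div_cancel₀ w two_ne_zero] at hdup
  have h2w : (2 : ℂ) ^ (1 - w) = 2 * 2 ^ (-w) := by
    rw [sub_eq_add_neg, Complex.cpow_add _ _ two_ne_zero, Complex.cpow_one]
  have hz : ((Y ^ 2 / 2 ^ (2 * (l + 1)) : ℝ) : ℂ) ^ (-w / 2) * ((2 : ℂ) ^ (-w)) ^ (l + 1) =
      (Y : ℂ) ^ (-w) := by
    have hz0 : 0 < Y ^ 2 / 2 ^ (2 * (l + 1)) := by positivity
    have hlog : Real.log (Y ^ 2 / 2 ^ (2 * (l + 1))) =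
        2 * Real.log Y - 2 * (l + 1) * Real.log 2 := by
      rw [Real.log_div (by positivity) (by positivity), Real.log_pow, Real.log_pow]
      push_cast
      ring
    rw [Complex.cpow_def_of_ne_zero (Complex.ofReal_ne_zero.mpr hz0.ne'),
      ← Complex.ofReal_log hz0.le, hlog, Complex.cpow_def_of_ne_zero
      (Complex.ofReal_ne_zero.mpr hY.ne'), ← Complex.ofReal_log hY.le,
      Complex.cpow_def_of_ne_zero two_ne_zero, ← Complex.exp_nat_mul, ← Complex.exp_add]
    congr 1
    have : Complex.log 2 = ((Real.log 2 : ℝ) : ℂ) := by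
      rw [Complex.ofReal_log (by norm_num), Complex.ofReal_ofNat]
    rw [this]
    push_cast
    ring
  rw [meijerIntegrand_psiParam hk, ← hz, psiKernel]
  have e1 : -(-w / 2) = w / 2 := by ring
  have e2 : 1 / 2 - -w / 2 = w / 2 + 1 / 2 := by ring
  have e3 : 1 / 2 + -w / 2 = 1 / 2 - w / 2 := by ring
  rw [e1, e2, e3, div_eq_mul_inv, ← inv_pow, inv_Gamma_one_sub_div_two hw, Nat.add_sub_cancel]
  have hf := psiFactor_mul_sqrt_pi_pow hk
  rw [Nat.add_sub_cancel] at hf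
  have hprod : Complex.Gamma (w / 2) ^ (l + 1) * Complex.Gamma (w / 2 + 1 / 2) ^ (l + 1) =
      Complex.Gamma w ^ (l + 1) * 2 ^ (l + 1) * ((2 : ℂ) ^ (-w)) ^ (l + 1) *
        ((√Real.pi : ℝ) : ℂ) ^ (l + 1) := by
    rw [← mul_pow, hdup, h2w]
    ring
  generalize ((Y ^ 2 / 2 ^ (2 * (l + 1)) : ℝ) : ℂ) ^ (-w / 2) = Z
  generalize (2 : ℂ) ^ (-w) = P at *
  generalize Complex.cos (Real.pi * w / 2) = c
  calc psiFactor (l + 1) * (Complex.Gamma (w / 2) ^ (l + 1) * Complex.Gamma (w / 2 + 1 / 2) *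
        (c * Complex.Gamma (w / 2 + 1 / 2) / Real.pi) ^ l * Z)
      = psiFactor (l + 1) * (Complex.Gamma (w / 2) ^ (l + 1) *
        Complex.Gamma (w / 2 + 1 / 2) ^ (l + 1)) * c ^ l / Real.pi ^ l * Z := by
        rw [div_pow, mul_pow]
        ring
    _ = (psiFactor (l + 1) * 2 ^ (l + 1) * ((√Real.pi : ℝ) : ℂ) ^ (l + 1)) *
        (Complex.Gamma w ^ (l + 1) * P ^ (l + 1)) * c ^ l / Real.pi ^ l * Z := by
        rw [hprod]
        ring
    _ = _ := by
        rw [hf]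
        field_simp

lemma integrable_of_norm_le_inv_one_add_sq {f : ℝ → ℂ} (hf : Continuous f) {A : ℝ}
    (h : ∀ y, ‖f y‖ ≤ A * (1 + y ^ 2)⁻¹) : MeasureTheory.Integrable f :=
  (integrable_inv_one_add_sq.const_mul A).mono' hf.aestronglyMeasurable
    (Filter.Eventually.of_forall h)

lemma continuous_vertical {F : ℂ → ℂ} {x : ℝ}
    (hF : ∀ w : ℂ, w.re = x → DifferentiableAt ℂ F w) :
    Continuous (fun y : ℝ => F (x + y * Complex.I)) :=
  continuous_iff_continuousAt.mpr fun y =>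
    ContinuousAt.comp (f := fun y : ℝ => (x + y * Complex.I : ℂ))
      (hF _ (by simp)).continuousAt (by fun_prop)

lemma differentiableAt_Gamma_of_re_pos {w : ℂ} (hw : 0 < w.re) :
    DifferentiableAt ℂ Complex.Gamma w := by
  refine Complex.differentiableAt_Gamma w fun m h => ?_
  rw [h] at hw
  simp at hw
  linarith [m.cast_nonneg (α := ℝ)]

lemma differentiableAt_psiKernel (k : ℕ) {w : ℂ} (hw : 0 < w.re) :
    DifferentiableAt ℂ (psiKernel k) w := by
  have h1 : DifferentiableAt ℂ (fun w : ℂ => Complex.cos (Real.pi * w / 2)) w := by fun_prop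
  exact ((differentiableAt_Gamma_of_re_pos hw).pow k).mul (h1.pow (k - 1))

lemma differentiableAt_psiKernel_mul_cpow (k : ℕ) {Y : ℝ} (hY : 0 < Y) {w : ℂ} (hw : 0 < w.re) :
    DifferentiableAt ℂ (fun w => psiKernel k w * (Y : ℂ) ^ (-w)) w := by
  refine (differentiableAt_psiKernel k hw).mul ?_
  have e1 : DifferentiableAt ℂ (fun s : ℂ => -s) w := by fun_prop
  exact e1.const_cpow (Or.inl (by exact_mod_cast hY.ne'))

lemma exists_norm_psiKernel_mul_cpow_le {k : ℕ} (hk : 1 ≤ k) {Y : ℝ} (hY : 0 < Y) {a b : ℝ}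
    (ha : 0 < a) : ∃ A : ℝ, 0 ≤ A ∧ ∀ w : ℂ, a ≤ w.re → w.re ≤ b →
      ‖psiKernel k w * (Y : ℂ) ^ (-w)‖ ≤ A * (1 + w.im ^ 2)⁻¹ := by
  obtain ⟨A, hA, h⟩ := exists_norm_psiKernel_le hk (a := a) (b := b) ha
  refine ⟨A * (Y ^ (-a) + Y ^ (-b)), by positivity, fun w h1 h2 => ?_⟩
  rw [norm_mul, Complex.norm_cpow_eq_rpow_re_of_pos hY, Complex.neg_re]
  have h3 : Y ^ (-w.re) ≤ Y ^ (-a) + Y ^ (-b) := by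
    rcases le_total 1 Y with hY1 | hY1
    · have := Real.rpow_le_rpow_of_exponent_le hY1 (neg_le_neg h1)
      linarith [Real.rpow_pos_of_pos hY (-b)]
    · have := Real.rpow_le_rpow_of_exponent_ge hY hY1 (neg_le_neg h2)
      linarith [Real.rpow_pos_of_pos hY (-a)]
  calc _ ≤ (A * (1 + w.im ^ 2)⁻¹) * (Y ^ (-a) + Y ^ (-b)) :=
        mul_le_mul (h w h1 h2) h3 (by positivity) (by positivity)
    _ = _ := by ring

lemma integrable_psiKernel_mul_cpow {k : ℕ} (hk : 1 ≤ k) {Y : ℝ} (hY : 0 < Y) {c : ℝ}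
    (hc : 0 < c) : MeasureTheory.Integrable (fun y : ℝ =>
      psiKernel k (c + y * Complex.I) * (Y : ℂ) ^ (-(c + y * Complex.I))) := by
  obtain ⟨A, -, h⟩ := exists_norm_psiKernel_mul_cpow_le hk hY (a := c) (b := c) hc
  refine integrable_of_norm_le_inv_one_add_sq (A := A)
    (continuous_vertical (F := fun w => psiKernel k w * (Y : ℂ) ^ (-w)) (x := c)
      fun w hw => differentiableAt_psiKernel_mul_cpow k hY (hw ▸ hc)) fun y => ?_
  simpa using h (c + y * Complex.I) (by simp) (by simp)

lemma psiFactor_mul_meijerIntegrand_vertical {k : ℕ} (hk : 1 ≤ k) {Y : ℝ} (hY : 0 < Y) {C : ℝ}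
    (hC : C < 0) (y : ℝ) :
    psiFactor k * meijerIntegrand (k + 1) 0 (Fin.elim0 : Fin 0 → ℂ) (psiParam k)
      ((Y ^ 2 / 2 ^ (2 * k) : ℝ) : ℂ) (C + y * Complex.I) =
    2 * (psiKernel k ((-2 * C : ℝ) + (-2 * y : ℝ) * Complex.I) *
      (Y : ℂ) ^ (-((-2 * C : ℝ) + (-2 * y : ℝ) * Complex.I : ℂ))) := by
  rw [← psiFactor_mul_meijerIntegrand hk hY (by simp; linarith)]
  congr 2
  push_cast
  ring

lemma integrable_meijerIntegrand {k : ℕ} (hk : 1 ≤ k) {Y : ℝ} (hY : 0 < Y) {C : ℝ}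
    (hC : C < 0) : MeasureTheory.Integrable (fun y : ℝ =>
      meijerIntegrand (k + 1) 0 (Fin.elim0 : Fin 0 → ℂ) (psiParam k)
        ((Y ^ 2 / 2 ^ (2 * k) : ℝ) : ℂ) (C + y * Complex.I)) := by
  have h := ((integrable_psiKernel_mul_cpow hk hY (c := -2 * C) (by linarith)).comp_mul_left'
    (R := -2) (by norm_num)).const_mul ((psiFactor k)⁻¹ * 2)
  refine h.congr (Filter.Eventually.of_forall fun y => ?_)
  dsimp only
  rw [mul_assoc, ← psiFactor_mul_meijerIntegrand_vertical hk hY hC,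
    inv_mul_cancel_left₀ (psiFactor_ne_zero k)]

lemma tendsto_integral_symm {f : ℝ → ℂ} (hf : MeasureTheory.Integrable f) :
    Filter.Tendsto (fun T : ℝ => ∫ y in -T..T, f y) Filter.atTop (nhds (∫ y, f y)) :=
  MeasureTheory.intervalIntegral_tendsto_integral hf Filter.tendsto_neg_atTop_atBot
    Filter.tendsto_id

lemma tendsto_const_mul_inv_one_add_sq (A : ℝ) :
    Filter.Tendsto (fun T : ℝ => A * (1 + T ^ 2)⁻¹) Filter.atTop (nhds 0) := by
  have h : Filter.Tendsto (fun T : ℝ => 1 + T ^ 2) Filter.atTop Filter.atTop :=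
    Filter.tendsto_atTop_add_const_left _ _ (Filter.tendsto_pow_atTop two_ne_zero)
  simpa using (tendsto_inv_atTop_zero.comp h).const_mul A

/-- The kernel has no poles in `Re w > 0`, so the line may be moved freely there; this is why `C <
0` is arbitrary. -/
lemma integral_psiKernel_mul_cpow_of_lt {k : ℕ} (hk : 1 ≤ k) {Y : ℝ} (hY : 0 < Y) {a b : ℝ}
    (ha : 0 < a) (hab : a < b) :
    ∫ y : ℝ, psiKernel k (b + y * Complex.I) * (Y : ℂ) ^ (-(b + y * Complex.I)) =
      ∫ y : ℝ, psiKernel k (a + y * Complex.I) * (Y : ℂ) ^ (-(a + y * Complex.I)) := by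
  obtain ⟨A, -, h⟩ := exists_norm_psiKernel_mul_cpow_le hk hY (a := a) (b := b) ha
  have h1 := tendsto_integral_vertical_sub_of_differentiableAt hab
    (F := fun w => psiKernel k w * (Y : ℂ) ^ (-w))
    (fun w hw _ => differentiableAt_psiKernel_mul_cpow k hY (ha.trans_le hw))
    (tendsto_const_mul_inv_one_add_sq A)
    (fun w hw1 hw2 _ => by simpa using h w hw1 hw2)
  have h2 := (tendsto_integral_symm (integrable_psiKernel_mul_cpow hk hY (ha.trans hab))).sub
    (tendsto_integral_symm (integrable_psiKernel_mul_cpow hk hY ha))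
  exact sub_eq_zero.mp (tendsto_nhds_unique h2 h1)

lemma integral_psiKernel_mul_cpow_eq {k : ℕ} (hk : 1 ≤ k) {Y : ℝ} (hY : 0 < Y) {a b : ℝ}
    (ha : 0 < a) (hb : 0 < b) :
    ∫ y : ℝ, psiKernel k (b + y * Complex.I) * (Y : ℂ) ^ (-(b + y * Complex.I)) =
      ∫ y : ℝ, psiKernel k (a + y * Complex.I) * (Y : ℂ) ^ (-(a + y * Complex.I)) := by
  rcases lt_trichotomy a b with h | rfl | h
  · exact integral_psiKernel_mul_cpow_of_lt hk hY ha h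
  · rfl
  · exact (integral_psiKernel_mul_cpow_of_lt hk hY hb h).symm

lemma psiFactor_mul_meijerG {k : ℕ} (hk : 1 ≤ k) {Y : ℝ} (hY : 0 < Y) {C c : ℝ} (hC : C < 0)
    (hc : 0 < c) :
    psiFactor k * meijerG (k + 1) 0 (Fin.elim0 : Fin 0 → ℂ) (psiParam k) C
      ((Y ^ 2 / 2 ^ (2 * k) : ℝ) : ℂ) =
    1 / (2 * Real.pi) *
      ∫ y : ℝ, psiKernel k (c + y * Complex.I) * (Y : ℂ) ^ (-(c + y * Complex.I)) := by
  have hpi : (Real.pi : ℂ) ≠ 0 := by exact_mod_cast Real.pi_ne_zero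
  -- The substitution `w = -2s` sends `Re s = C` to `Re w = -2C`; its Jacobian `1/2` cancels the
  -- factor `2` in front of the kernel.
  have h := MeasureTheory.Measure.integral_comp_mul_left (fun y : ℝ =>
    psiKernel k ((-2 * C : ℝ) + y * Complex.I) *
      (Y : ℂ) ^ (-((-2 * C : ℝ) + y * Complex.I : ℂ))) (-2)
  have h' : psiFactor k * ∫ y : ℝ, meijerIntegrand (k + 1) 0 (Fin.elim0 : Fin 0 → ℂ) (psiParam k)
      ((Y ^ 2 / 2 ^ (2 * k) : ℝ) : ℂ) (C + y * Complex.I) =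
      ∫ y : ℝ, psiKernel k (c + y * Complex.I) * (Y : ℂ) ^ (-(c + y * Complex.I)) := by
    rw [← MeasureTheory.integral_const_mul]
    simp_rw [psiFactor_mul_meijerIntegrand_vertical hk hY hC]
    rw [MeasureTheory.integral_const_mul, h,
      integral_psiKernel_mul_cpow_eq hk hY (a := -2 * C) (by linarith) hc, Complex.real_smul]
    norm_num
    ring
  rw [meijerG, MeasureTheory.integral_mul_const, ← h']
  field_simp

/-! ### Summation under the integral sign -/

lemma norm_piltz_mul_cpow (k : ℕ) (n : ℕ+) (c y : ℝ) :
    ‖(piltz k n : ℂ) * (n : ℂ) ^ (-(c + y * Complex.I))‖ = piltz k n * (n : ℝ) ^ (-c) := by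
  rw [norm_mul, norm_natCast_cpow, Complex.norm_natCast]
  simp

lemma continuous_natCast_cpow_vertical (n : ℕ+) (c : ℝ) :
    Continuous fun y : ℝ => (n : ℂ) ^ (-(c + y * Complex.I)) := by
  have e1 : Continuous fun y : ℝ => -(c + y * Complex.I : ℂ) := by fun_prop
  exact e1.const_cpow (Or.inl (by exact_mod_cast n.ne_zero))

lemma integrable_mul_piltz_mul_cpow (k : ℕ) {H : ℝ → ℂ} (hH : MeasureTheory.Integrable H)
    (c : ℝ) (n : ℕ+) : MeasureTheory.Integrable (fun y : ℝ =>
      H y * ((piltz k n : ℂ) * (n : ℂ) ^ (-(c + y * Complex.I)))) := by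
  refine hH.mul_bdd (c := piltz k n * (n : ℝ) ^ (-c)) ?_ ?_
  · exact (continuous_const.mul (continuous_natCast_cpow_vertical n c)).aestronglyMeasurable
  · exact Filter.Eventually.of_forall fun y => (norm_piltz_mul_cpow k n c y).le

/-- Termwise integration of the Dirichlet series of `ζ ^ k` against an integrable function. -/
lemma hasSum_integral_mul_piltz (k : ℕ) {H : ℝ → ℂ} (hH : MeasureTheory.Integrable H) {c : ℝ}
    (hc : 1 < c) :
    HasSum (fun n : ℕ+ => ∫ y : ℝ, H y * ((piltz k n : ℂ) * (n : ℂ) ^ (-(c + y * Complex.I))))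
      (∫ y : ℝ, H y * riemannZeta (c + y * Complex.I) ^ k) := by
  have h := MeasureTheory.hasSum_integral_of_summable_integral_norm
    (F := fun (n : ℕ+) (y : ℝ) => H y * ((piltz k n : ℂ) * (n : ℂ) ^ (-(c + y * Complex.I))))
    (fun n => integrable_mul_piltz_mul_cpow k hH c n) (by
      simp_rw [norm_mul (H _), norm_piltz_mul_cpow, MeasureTheory.integral_mul_const]
      exact (summable_piltz_mul_rpow k hc).mul_left _)
  have e : ∫ y : ℝ, H y * riemannZeta (c + y * Complex.I) ^ k =
      ∫ y : ℝ, ∑' n : ℕ+, H y * ((piltz k n : ℂ) * (n : ℂ) ^ (-(c + y * Complex.I))) := by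
    congr 1
    funext y
    rw [tsum_mul_left, (hasSum_piltz_mul_cpow k (by simpa using hc)).tsum_eq]
  rw [e]
  exact h

lemma integrable_mul_riemannZeta_pow (k : ℕ) {H : ℝ → ℂ} (hH : MeasureTheory.Integrable H) {c : ℝ}
    (hc : 1 < c) :
    MeasureTheory.Integrable (fun y : ℝ => H y * riemannZeta (c + y * Complex.I) ^ k) := by
  refine hH.mul_bdd (c := ∑' n : ℕ+, (piltz k n : ℝ) * (n : ℝ) ^ (-c)) ?_ ?_
  · refine (Continuous.pow (continuous_vertical fun w hw => ?_) k).aestronglyMeasurable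
    refine differentiableAt_riemannZeta fun h => ?_
    rw [h] at hw
    simp at hw
    linarith
  · refine Filter.Eventually.of_forall fun y => ?_
    rw [← (hasSum_piltz_mul_cpow k (s := c + y * Complex.I) (by simpa using hc)).tsum_eq]
    exact tsum_of_norm_bounded (summable_piltz_mul_rpow k hc).hasSum
      fun n => (norm_piltz_mul_cpow k n c y).le

lemma ofReal_mul_cpow {a b : ℝ} (ha : 0 < a) (hb : 0 < b) (s : ℂ) :
    ((a * b : ℝ) : ℂ) ^ s = (a : ℂ) ^ s * (b : ℂ) ^ s := by
  rw [Complex.ofReal_mul, Complex.mul_cpow_ofReal_nonneg ha.le hb.le]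

lemma psiFactor_mul_psiTerm {k : ℕ} (hk : 1 ≤ k) {C c ρ x : ℝ} (hC : C < 0) (hc : 0 < c)
    (hρ : 0 < ρ) (hx : 0 < x) (j : ℕ+) :
    psiFactor k * psiTerm C ρ k x j =
      ∫ y : ℝ, (1 / (2 * Real.pi) * (psiKernel k (c + y * Complex.I) *
        ((ρ * x : ℝ) : ℂ) ^ (-(c + y * Complex.I)))) *
          ((piltz k j : ℂ) * (j : ℂ) ^ (-(c + y * Complex.I))) := by
  have hj : 0 < (j : ℝ) := by exact_mod_cast j.pos
  have hY : 0 < ρ * x * j := by positivity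
  have e : (ρ ^ 2 * (j : ℝ) ^ 2 * x ^ 2 / 2 ^ (2 * k) : ℝ) =
      (ρ * x * j) ^ 2 / 2 ^ (2 * k) := by ring
  rw [psiTerm, e, mul_left_comm, psiFactor_mul_meijerG hk hY hC hc,
    ← MeasureTheory.integral_const_mul, ← MeasureTheory.integral_const_mul]
  congr 1
  funext y
  rw [ofReal_mul_cpow (mul_pos hρ hx) hj, Complex.ofReal_natCast]
  ring

lemma hasSum_psiTerm {k : ℕ} (hk : 1 ≤ k) {C c ρ x : ℝ} (hC : C < 0) (hc : 1 < c)
    (hρ : 0 < ρ) (hx : 0 < x) :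
    HasSum (fun j : ℕ+ => psiFactor k * psiTerm C ρ k x j)
      (∫ y : ℝ, (1 / (2 * Real.pi) * (psiKernel k (c + y * Complex.I) *
        ((ρ * x : ℝ) : ℂ) ^ (-(c + y * Complex.I)))) * riemannZeta (c + y * Complex.I) ^ k) := by
  simp_rw [psiFactor_mul_psiTerm hk hC (zero_lt_one.trans hc) hρ hx]
  exact hasSum_integral_mul_piltz k ((integrable_psiKernel_mul_cpow hk (mul_pos hρ hx)
    (zero_lt_one.trans hc)).const_mul _) hc

lemma summable_psiTerm {k : ℕ} (hk : 1 ≤ k) {C ρ x : ℝ} (hC : C < 0) (hρ : 0 < ρ) (hx : 0 < x) :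
    Summable (fun j : ℕ+ => psiTerm C ρ k x j) :=
  (summable_mul_left_iff (psiFactor_ne_zero k)).mp
    (hasSum_psiTerm hk hC (c := 2) (by norm_num) hρ hx).summable

lemma psi_eq_integral {k : ℕ} (hk : 1 ≤ k) {C c ρ x : ℝ} (hC : C < 0) (hc : 1 < c)
    (hρ : 0 < ρ) (hx : 0 < x) :
    psi C ρ k x = ∫ y : ℝ, (1 / (2 * Real.pi) * (psiKernel k (c + y * Complex.I) *
        ((ρ * x : ℝ) : ℂ) ^ (-(c + y * Complex.I)))) * riemannZeta (c + y * Complex.I) ^ k := by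
  rw [← (hasSum_psiTerm hk hC hc hρ hx).tsum_eq, tsum_mul_left]
  rfl

/-- The Mellin transform of the kernel of `∑ n, d_k(n) n ^ (-(2 m + 1)) Ψ_{ρ,k}(n)`. -/
def lerchKernel (m : ℤ) (k : ℕ) (ρ : ℝ) (w : ℂ) : ℂ :=
  psiKernel k w * (ρ : ℂ) ^ (-w) * riemannZeta w ^ k * riemannZeta (2 * m + 1 + w) ^ k

lemma integrable_psiKernel_mul_zeta {k : ℕ} (hk : 1 ≤ k) {ρ c : ℝ} (hρ : 0 < ρ) (hc : 1 < c) :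
    MeasureTheory.Integrable (fun y : ℝ => psiKernel k (c + y * Complex.I) *
      (ρ : ℂ) ^ (-(c + y * Complex.I)) * riemannZeta (c + y * Complex.I) ^ k) :=
  integrable_mul_riemannZeta_pow k (integrable_psiKernel_mul_cpow hk hρ (by linarith)) hc

lemma integrable_lerchKernel {k : ℕ} (hk : 1 ≤ k) (m : ℤ) {ρ c : ℝ} (hρ : 0 < ρ) (hc : 1 < c)
    (hcm : 1 < 2 * m + 1 + c) :
    MeasureTheory.Integrable (fun y : ℝ => lerchKernel m k ρ (c + y * Complex.I)) := by
  refine (integrable_mul_riemannZeta_pow k (integrable_psiKernel_mul_zeta hk hρ hc) hcm).congr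
    (Filter.Eventually.of_forall fun y => ?_)
  simp only [lerchKernel]
  congr 3
  push_cast
  ring

lemma hasSum_lerch {k : ℕ} (hk : 1 ≤ k) (m : ℤ) {C c ρ : ℝ} (hC : C < 0) (hρ : 0 < ρ)
    (hc : 1 < c) (hcm : 1 < 2 * m + 1 + c) :
    HasSum (fun n : ℕ+ => (piltz k n : ℂ) / (n : ℂ) ^ (2 * m + 1) * psi C ρ k n)
      (1 / (2 * Real.pi) * ∫ y : ℝ, lerchKernel m k ρ (c + y * Complex.I)) := by
  have h := (hasSum_integral_mul_piltz k (integrable_psiKernel_mul_zeta hk hρ hc) hcm).mul_left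
    (1 / (2 * Real.pi) : ℂ)
  have e : ∫ y : ℝ, lerchKernel m k ρ (c + y * Complex.I) = ∫ y : ℝ,
      psiKernel k (c + y * Complex.I) * (ρ : ℂ) ^ (-(c + y * Complex.I)) *
        riemannZeta (c + y * Complex.I) ^ k *
          riemannZeta ((2 * m + 1 + c : ℝ) + y * Complex.I) ^ k := by
    congr 1
    funext y
    simp only [lerchKernel]
    congr 3
    push_cast
    ring
  rw [e]
  refine (congrArg (fun f => HasSum f _) (funext fun n : ℕ+ => ?_)).mpr h
  · have hn : 0 < (n : ℝ) := by exact_mod_cast n.pos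
    have hn0 : (n : ℂ) ≠ 0 := by exact_mod_cast n.ne_zero
    rw [psi_eq_integral hk hC hc hρ hn, ← MeasureTheory.integral_const_mul,
      ← MeasureTheory.integral_const_mul]
    congr 1
    funext y
    -- The weight `n^(-(2m+1))` shifts the exponent, so the sum over `n` is the series of `ζ^k` on
    -- the line `Re = 2m + 1 + c`.
    have e : (n : ℂ) ^ (-(((2 * m + 1 + c : ℝ) : ℂ) + y * Complex.I)) =
        (n : ℂ) ^ (-(c + y * Complex.I : ℂ)) / (n : ℂ) ^ (2 * m + 1) := by
      rw [← Complex.cpow_intCast, ← Complex.cpow_sub _ _ hn0]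
      congr 1
      push_cast
      ring
    rw [ofReal_mul_cpow hρ hn, e, Complex.ofReal_natCast]
    ring

/-! ### The case `k = 1` of `Ψ` -/

/-- By Mellin inversion of `Γ` the `j`-th term is `exp(-ρxj)`, and the series over `j` is geometric.
-/
lemma psi_one_eq {C : ℝ} (hC : C < 0) {ρ x : ℝ} (hρ : 0 < ρ) (hx : 0 < x) :
    psi C ρ 1 x = 1 / (Complex.exp (ρ * x) - 1) := by
  have hterm : ∀ j : ℕ+, psiFactor 1 * psiTerm C ρ 1 x j =
      Complex.exp (-(ρ * x)) * Complex.exp (-(ρ * x)) ^ (j.natPred) := by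
    intro j
    have hj : 0 < (j : ℝ) := by exact_mod_cast j.pos
    have hY : 0 < ρ * x * j := by positivity
    have hmell : ∀ s : ℂ, 0 < s.re →
        mellin (fun x => ((Real.exp (-x) : ℝ) : ℂ)) s = Complex.Gamma s := fun s hs => by
      rw [Complex.Gamma_eq_integral hs, Complex.GammaIntegral_eq_mellin]
    have hinv := mellinInv_mellin_eq 1 (fun x => ((Real.exp (-x) : ℝ) : ℂ)) hY
      (by
        have := Complex.GammaIntegral_convergent (s := ((1 : ℝ) : ℂ)) (by simp)
        refine this.congr_fun (fun x _ => ?_) measurableSet_Ioi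
        rw [smul_eq_mul, mul_comm])
      (by
        -- With `Y = 1` the power is trivial, so this is the integrability of Γ itself on `Re w =
        -- 1`.
        have := integrable_psiKernel_mul_cpow le_rfl one_pos (c := 1) one_pos
        refine this.congr (Filter.Eventually.of_forall fun y => ?_)
        dsimp only
        rw [hmell _ (by simp)]
        simp [psiKernel])
      (by fun_prop)
    have e : (ρ ^ 2 * (j : ℝ) ^ 2 * x ^ 2 / 2 ^ (2 * 1) : ℝ) =
      (ρ * x * j) ^ 2 / 2 ^ (2 * 1) := by ring
    rw [psiTerm, e, mul_left_comm, psiFactor_mul_meijerG le_rfl hY hC one_pos]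
    rw [piltz_one j.ne_zero, Nat.cast_one, one_mul, ← pow_succ', PNat.natPred_add_one, ← Complex.exp_nat_mul]
    have e2 : ((Real.exp (-(ρ * x * j)) : ℝ) : ℂ) = Complex.exp (j * -(ρ * x)) := by
      push_cast
      congr 1
      ring
    rw [← e2, ← hinv, mellinInv, Complex.real_smul]
    congr 1
    · push_cast
      rfl
    · congr 1
      funext y
      rw [hmell _ (by simp), smul_eq_mul, psiKernel]
      simp
      ring
  have hlt : ‖Complex.exp (-(ρ * x))‖ < 1 := by
    rw [Complex.norm_exp, Real.exp_lt_one_iff]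
    have := mul_pos hρ hx
    simpa using this
  have hgeo := (hasSum_geometric_of_norm_lt_one hlt).mul_left (Complex.exp (-(ρ * x)))
  have hsum : HasSum (fun j : ℕ+ => psiFactor 1 * psiTerm C ρ 1 x j)
      (Complex.exp (-(ρ * x)) * (1 - Complex.exp (-(ρ * x)))⁻¹) := by
    simp_rw [hterm]
    exact (Equiv.pnatEquivNat.hasSum_iff (f := fun n : ℕ => Complex.exp (-(ρ * x)) *
      Complex.exp (-(ρ * x)) ^ n)).mpr hgeo
  have h : psi C ρ 1 x = ∑' j : ℕ+, psiFactor 1 * psiTerm C ρ 1 x j := by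
    rw [tsum_mul_left]
    rfl
  rw [h, hsum.tsum_eq, Complex.exp_neg]
  have hE := Complex.exp_ne_zero (ρ * x : ℂ)
  rw [← mul_inv, mul_sub, mul_one, mul_inv_cancel₀ hE, one_div]

/-! ### The reflected kernel and its symmetry -/

/-- The kernel `lerchKernel m k ((2 π) ^ k)` after the functional equation of `ζ`. -/
def lerchReflected (m : ℤ) (k : ℕ) (w : ℂ) : ℂ :=
  ((2 : ℂ) ^ k)⁻¹ * riemannZeta (1 - w) ^ k * riemannZeta (2 * m + 1 + w) ^ k /
    Complex.cos (Real.pi * w / 2)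

lemma ofReal_pow_cpow {a : ℝ} (ha : 0 < a) (k : ℕ) (s : ℂ) :
    ((a ^ k : ℝ) : ℂ) ^ s = ((a : ℂ) ^ s) ^ k := by
  induction k with
  | zero => simp
  | succ k ih => rw [pow_succ, pow_succ, ofReal_mul_cpow (pow_pos ha k) ha, ih]

/-- The `k`-th power of the functional equation needs `cos^k`, while the kernel carries `cos^(k-1)`;
hence exactly one cosine in the denominator. -/
lemma lerchKernel_eq_lerchReflected {k : ℕ} (hk : 1 ≤ k) (m : ℤ) {w : ℂ}
    (hw0 : ∀ n : ℕ, w ≠ -n) (hw1 : w ≠ 1) (hcos : Complex.cos (Real.pi * w / 2) ≠ 0) :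
    lerchKernel m k ((2 * Real.pi) ^ k) w = lerchReflected m k w := by
  obtain ⟨l, rfl⟩ : ∃ l, k = l + 1 := ⟨k - 1, by omega⟩
  rw [lerchKernel, lerchReflected, riemannZeta_one_sub hw0 hw1, psiKernel,
    ofReal_pow_cpow Real.two_pi_pos, Nat.add_sub_cancel]
  push_cast
  generalize Complex.cos (Real.pi * w / 2) = c at *
  generalize (2 * Real.pi : ℂ) ^ (-w) = P
  rw [mul_pow, mul_pow, mul_pow, mul_pow, pow_succ c]
  field_simp

lemma cos_intCast_mul_pi (n : ℤ) : Complex.cos (n * Real.pi) = (-1) ^ n := by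
  have h := congrArg Complex.ofReal (Real.cos_int_mul_pi n)
  push_cast at h
  exact h

/-- The reflection exchanges the two zeta factors and shifts the argument of the cosine by `mπ`, up
to parity; the sign is `(-1)^m = -1`. -/
lemma lerchReflected_reflect {m : ℤ} (hm : Odd m) (k : ℕ) (w : ℂ) :
    lerchReflected m k (-2 * m - w) = -lerchReflected m k w := by
  have e1 : 1 - (-2 * m - w) = 2 * m + 1 + w := by ring
  have e2 : 2 * m + 1 + (-2 * m - w) = 1 - w := by ring
  have e3 : Complex.cos (Real.pi * (-2 * m - w) / 2) = -Complex.cos (Real.pi * w / 2) := by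
    rw [← Complex.cos_neg, show -(Real.pi * (-2 * m - w) / 2 : ℂ) = Real.pi * w / 2 + m * Real.pi by
      ring, Complex.cos_add, cos_intCast_mul_pi, Complex.sin_int_mul_pi, hm.neg_one_zpow, mul_zero,
      sub_zero, mul_neg_one]
  rw [lerchReflected, lerchReflected, e1, e2, e3, div_neg]
  ring

lemma differentiableAt_lerchReflected (m : ℤ) (k : ℕ) {w : ℂ} (hw0 : w ≠ 0) (hw1 : w ≠ -2 * m)
    (hcos : Complex.cos (Real.pi * w / 2) ≠ 0) :
    DifferentiableAt ℂ (lerchReflected m k) w := by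
  have h1 : DifferentiableAt ℂ (fun w : ℂ => riemannZeta (1 - w)) w :=
    DifferentiableAt.fun_comp' w (differentiableAt_riemannZeta (by
      intro h
      apply hw0
      linear_combination -h)) (by fun_prop)
  have h2 : DifferentiableAt ℂ (fun w : ℂ => riemannZeta (2 * m + 1 + w)) w :=
    DifferentiableAt.fun_comp' w (differentiableAt_riemannZeta (by
      intro h
      apply hw1
      linear_combination h)) (by fun_prop)
  have h3 : DifferentiableAt ℂ (fun w : ℂ => Complex.cos (Real.pi * w / 2)) w := by fun_prop
  exact (((differentiableAt_const _).mul (h1.pow k)).mul (h2.pow k)).div h3 hcos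

/-- From `‖cos z‖ ≥ sinh |Im z|`: with `E = exp(π|Im w|/2) ≥ 2` one has `(E - 1)/2 ≥ E/4`. -/
lemma exp_div_four_le_norm_cos {w : ℂ} (hw : 1 ≤ |w.im|) :
    Real.exp (Real.pi * |w.im| / 2) / 4 ≤ ‖Complex.cos (Real.pi * w / 2)‖ := by
  have key : ∀ z : ℂ, (Real.exp |z.im| - Real.exp (-|z.im|)) / 2 ≤ ‖Complex.cos z‖ := by
    intro z
    rw [Complex.cos, norm_div, Complex.norm_two]
    have h1 : ‖Complex.exp (z * Complex.I)‖ = Real.exp (-z.im) := by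
      rw [Complex.norm_exp]
      simp
    have h2 : ‖Complex.exp (-z * Complex.I)‖ = Real.exp z.im := by
      rw [Complex.norm_exp]
      simp
    have h3 := norm_sub_norm_le (Complex.exp (z * Complex.I)) (-Complex.exp (-z * Complex.I))
    have h4 := norm_sub_norm_le (Complex.exp (-z * Complex.I)) (-Complex.exp (z * Complex.I))
    rw [sub_neg_eq_add, norm_neg, h1, h2] at h3 h4
    rw [add_comm] at h4
    rcases abs_cases z.im with ⟨h, _⟩ | ⟨h, _⟩ <;> rw [h]
    · linarith
    · rw [neg_neg]
      linarith
  have h := key (Real.pi * w / 2)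
  have e : |(Real.pi * w / 2 : ℂ).im| = Real.pi * |w.im| / 2 := by
    rw [im_pi_mul_div_two, abs_div, abs_mul, abs_of_pos Real.pi_pos, abs_two]
  rw [e] at h
  have hexp : 2 ≤ Real.exp (Real.pi * |w.im| / 2) := by
    have := Real.add_one_le_exp (Real.pi * |w.im| / 2)
    nlinarith [Real.pi_gt_three]
  have hneg : Real.exp (-(Real.pi * |w.im| / 2)) ≤ 1 := by
    rw [Real.exp_le_one_iff]
    have := Real.pi_pos
    have : 0 ≤ Real.pi * |w.im| / 2 := by positivity
    linarith
  linarith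

lemma exists_norm_lerchReflected_le (m : ℤ) (k : ℕ) (a b : ℝ) :
    ∃ A : ℝ, ∀ w : ℂ, a ≤ w.re → w.re ≤ b → 1 ≤ |w.im| →
      ‖lerchReflected m k w‖ ≤ A * (1 + |w.im| ^ 2)⁻¹ := by
  obtain ⟨A, hA, N, h⟩ := exists_norm_riemannZeta_le (1 - b) (1 - a)
  obtain ⟨A', hA', N', h'⟩ := exists_norm_riemannZeta_le (2 * m + 1 + a) (2 * m + 1 + b)
  refine ⟨4 * A ^ k * A' ^ k * ((N * k + N' * k + 2).factorial * Real.exp 1),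
    fun w h1 h2 h3 => ?_⟩
  have hb := h (1 - w) (by simp; linarith) (by simp; linarith) (by simpa using h3)
  have hb' := h' (2 * m + 1 + w) (by simpa using h1) (by simpa using h2) (by simpa using h3)
  simp only [Complex.sub_im, Complex.one_im, zero_sub, abs_neg] at hb
  have e : (2 * m + 1 + w : ℂ).im = w.im := by simp
  rw [e] at hb'
  have hc := exp_div_four_le_norm_cos h3
  have hE := Real.exp_pos (Real.pi * |w.im| / 2)
  have h2k : ‖((2 : ℂ) ^ k)⁻¹‖ ≤ 1 := by
    rw [norm_inv, norm_pow, Complex.norm_two]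
    exact inv_le_one_of_one_le₀ (one_le_pow₀ one_le_two)
  rw [lerchReflected, norm_div, norm_mul, norm_mul, norm_pow, norm_pow]
  calc _ ≤ 1 * (A * (1 + |w.im|) ^ N) ^ k * (A' * (1 + |w.im|) ^ N') ^ k /
        (Real.exp (Real.pi * |w.im| / 2) / 4) := by gcongr
    _ = 4 * A ^ k * A' ^ k * ((1 + |w.im|) ^ (N * k + N' * k) *
        Real.exp (-(Real.pi * |w.im| / 2))) := by
        rw [mul_pow, mul_pow, ← pow_mul, ← pow_mul, pow_add, Real.exp_neg]
        field_simp
    _ ≤ 4 * A ^ k * A' ^ k * (((N * k + N' * k + 2).factorial * Real.exp 1) *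
        (1 + w.im ^ 2)⁻¹) :=
        mul_le_mul_of_nonneg_left (one_add_abs_pow_mul_exp_le _ _) (by positivity)
    _ = _ := by
        rw [sq_abs]
        ring

/-! ### Computation of the residues -/

/-- The function whose `(k - 1)`-st Taylor coefficient at `0` is the residue of
`lerchReflected m k` at `0`. -/
def lerchNumerator (m : ℤ) (k : ℕ) (s : ℂ) : ℂ :=
  riemannZeta (2 * m + 1 + s) ^ k * riemannZeta s ^ k * Complex.Gamma (s + 1) ^ k *
    Complex.cos (Real.pi * s / 2) ^ (k - 1) * (2 * Real.pi : ℂ) ^ (-(k * s))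

lemma two_mul_add_one_ne_one {m : ℤ} (hm : Odd m) : (2 * m + 1 : ℂ) ≠ 1 := by
  intro h
  have h' : 2 * m + 1 = 1 := by exact_mod_cast h
  obtain ⟨r, hr⟩ := hm
  omega

lemma two_pi_ne_zero_complex : (2 * Real.pi : ℂ) ≠ 0 := by
  exact_mod_cast Real.two_pi_pos.ne'

lemma analyticAt_lerchNumerator {m : ℤ} (hm : Odd m) (k : ℕ) :
    AnalyticAt ℂ (lerchNumerator m k) 0 := by
  have hz1 : ∀ᶠ s : ℂ in nhds 0, s ≠ 1 := isOpen_ne.mem_nhds zero_ne_one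
  have hz2 : ∀ᶠ s : ℂ in nhds 0, 2 * m + 1 + s ≠ 1 :=
    (isOpen_ne_fun (by fun_prop) continuous_const).mem_nhds (by
      simpa using two_mul_add_one_ne_one hm)
  have hz3 : ∀ᶠ s : ℂ in nhds 0, -1 < s.re :=
    (isOpen_lt continuous_const Complex.continuous_re).mem_nhds (by simp)
  rw [Complex.analyticAt_iff_eventually_differentiableAt]
  filter_upwards [hz1, hz2, hz3] with s h1 h2 h3
  have d1 : DifferentiableAt ℂ (fun s : ℂ => riemannZeta (2 * m + 1 + s)) s :=
    DifferentiableAt.fun_comp' s (differentiableAt_riemannZeta h2) (by fun_prop)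
  have d2 : DifferentiableAt ℂ (fun s : ℂ => Complex.Gamma (s + 1)) s :=
    DifferentiableAt.fun_comp' s (differentiableAt_Gamma_of_re_pos (by simp; linarith))
      (by fun_prop)
  have d3 : DifferentiableAt ℂ (fun s : ℂ => Complex.cos (Real.pi * s / 2)) s := by fun_prop
  have d4 : DifferentiableAt ℂ (fun s : ℂ => -(k * s)) s := by fun_prop
  exact ((((d1.pow k).mul ((differentiableAt_riemannZeta h1).pow k)).mul (d2.pow k)).mul
    (d3.pow (k - 1))).mul (d4.const_cpow (Or.inl two_pi_ne_zero_complex))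

/-- Near `0` the form before the functional equation is the convenient one: `Γ(w) = Γ(w+1)/w` shows
the pole of order at most `k`, and the other factors are analytic because `m ≠ 0`. -/
lemma hasResidue_lerchReflected_zero {m : ℤ} (hm : Odd m) {k : ℕ} (hk : 1 ≤ k) :
    HasResidue (lerchReflected m k) 0
      (iteratedDeriv (k - 1) (lerchNumerator m k) 0 / (k - 1).factorial) := by
  refine hasResidue_zero_of_eq_div_pow (analyticAt_lerchNumerator hm k) ?_
  have hz1 : ∀ᶠ s : ℂ in nhds 0, ‖s‖ < 1 :=
    (isOpen_lt continuous_norm continuous_const).mem_nhds (by simp)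
  have hz2 : ∀ᶠ s : ℂ in nhds 0, Complex.cos (Real.pi * s / 2) ≠ 0 :=
    (isOpen_ne_fun (by fun_prop) continuous_const).mem_nhds (by simp)
  filter_upwards [hz1.filter_mono nhdsWithin_le_nhds, hz2.filter_mono nhdsWithin_le_nhds,
    self_mem_nhdsWithin] with w h1 h2 h3
  have h3 : w ≠ 0 := h3
  have hw0 : ∀ n : ℕ, w ≠ -n := by
    rintro n rfl
    rw [norm_neg, Complex.norm_natCast] at h1
    have hn : n < 1 := by exact_mod_cast h1
    apply h3
    obtain rfl : n = 0 := by omega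
    simp
  have hw1 : w ≠ 1 := by
    rintro rfl
    simp at h1
  rw [← lerchKernel_eq_lerchReflected hk m hw0 hw1 h2, lerchKernel, lerchNumerator, psiKernel,
    Complex.Gamma_add_one w h3, ofReal_pow_cpow Real.two_pi_pos,
    show -(k * w) = k * (-w) by ring, Complex.cpow_nat_mul, Nat.sub_add_cancel hk]
  push_cast
  rw [mul_pow]
  field_simp

/-- The residue of `lerchReflected m k` at the odd integer `1 - 2 n`. -/
def oddResidue (m : ℤ) (k : ℕ) (n : ℤ) : ℂ :=
  ((2 : ℂ) ^ k)⁻¹ * riemannZeta (2 * n) ^ k * riemannZeta (2 * (m + 1 - n)) ^ k /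
    (-(-1) ^ n * (Real.pi / 2))

/-- The zeta factors have their poles at the even points `0` and `-2m`, so at an odd point only the
simple zero of the cosine matters. -/
lemma hasResidue_lerchReflected_odd {m : ℤ} (k : ℕ) (n : ℤ) :
    HasResidue (lerchReflected m k) (1 - 2 * n) (oddResidue m k n) := by
  have hp0 : (1 - 2 * n : ℂ) ≠ 0 := by
    intro h
    have : 1 - 2 * n = 0 := by exact_mod_cast h
    omega
  have hp1 : (1 - 2 * n : ℂ) ≠ -2 * m := by
    intro h
    have : 1 - 2 * n = -2 * m := by exact_mod_cast h
    omega
  have hA : AnalyticAt ℂ (fun w => ((2 : ℂ) ^ k)⁻¹ * riemannZeta (1 - w) ^ k *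
      riemannZeta (2 * m + 1 + w) ^ k) (1 - 2 * n) := by
    rw [Complex.analyticAt_iff_eventually_differentiableAt]
    filter_upwards [isOpen_ne.mem_nhds hp0, isOpen_ne.mem_nhds hp1] with w h0 h1
    have d1 : DifferentiableAt ℂ (fun w : ℂ => riemannZeta (1 - w)) w :=
      DifferentiableAt.fun_comp' w (differentiableAt_riemannZeta (by
        intro h
        apply h0
        linear_combination -h)) (by fun_prop)
    have d2 : DifferentiableAt ℂ (fun w : ℂ => riemannZeta (2 * m + 1 + w)) w :=
      DifferentiableAt.fun_comp' w (differentiableAt_riemannZeta (by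
        intro h
        apply h1
        linear_combination h)) (by fun_prop)
    exact ((differentiableAt_const _).mul (d1.pow k)).mul (d2.pow k)
  have hD : Differentiable ℂ (fun w : ℂ => Complex.cos (Real.pi * w / 2)) := by fun_prop
  have harg : (Real.pi * (1 - 2 * n) / 2 : ℂ) = Real.pi / 2 - n * Real.pi := by ring
  have hD0 : Complex.cos (Real.pi * (1 - 2 * n) / 2) = 0 := by
    rw [harg, Complex.cos_sub, Complex.sin_int_mul_pi, Complex.cos_pi_div_two, mul_zero, zero_mul,
      add_zero]
  have hD1 : deriv (fun w : ℂ => Complex.cos (Real.pi * w / 2)) (1 - 2 * n) =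
      -(-1) ^ n * (Real.pi / 2) := by
    have h1 : HasDerivAt (fun w : ℂ => (Real.pi * w / 2 : ℂ)) (Real.pi / 2) (1 - 2 * n) := by
      have := ((hasDerivAt_id (1 - 2 * n : ℂ)).const_mul (Real.pi : ℂ)).div_const 2
      simpa using this
    rw [h1.ccos.deriv, harg, Complex.sin_sub, Complex.sin_int_mul_pi, cos_intCast_mul_pi,
      Complex.sin_pi_div_two, mul_zero, sub_zero, one_mul, neg_mul]
  have hpi : (Real.pi : ℂ) ≠ 0 := by exact_mod_cast Real.pi_ne_zero
  have h := hasResidue_div_of_simple_zero hA hD hD0 (by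
    rw [hD1]
    refine mul_ne_zero (neg_ne_zero.mpr (zpow_ne_zero _ (by norm_num))) (div_ne_zero hpi two_ne_zero))
  rw [hD1] at h
  have e : (2 * m + 1 + (1 - 2 * n) : ℂ) = 2 * (m + 1 - n) := by ring
  rw [sub_sub_cancel, e] at h
  exact h

/-- This form of Euler's formula also covers `n = 0`, where it reads `ζ(0) = -1/2`; both ends of the
Bernoulli sum need it. -/
lemma riemannZeta_two_mul_nat_eq (n : ℕ) :
    riemannZeta (2 * n) = (-1) ^ (n + 1) * (2 * Real.pi : ℂ) ^ (2 * n) * bernoulli (2 * n) /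
      (2 * (2 * n).factorial) := by
  rcases Nat.eq_zero_or_pos n with rfl | hn
  · simp [riemannZeta_zero]
  · rw [riemannZeta_two_mul_nat hn.ne', mul_pow]
    have e : (2 : ℂ) ^ (2 * n) = 2 * 2 ^ (2 * n - 1) := by
      rw [← pow_succ']
      congr 1
      omega
    rw [e]
    field_simp

lemma riemannZeta_two_mul_int_of_neg {n : ℤ} (hn : n < 0) : riemannZeta (2 * n) = 0 := by
  obtain ⟨j, hj⟩ : ∃ j : ℕ, n = -(j + 1) := ⟨(-n - 1).toNat, by omega⟩
  have := riemannZeta_neg_two_mul_nat_add_one j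
  rw [← this, hj]
  congr 1
  push_cast
  ring

/-- Outside `0 ≤ n ≤ m + 1` one of the two zeta values is a trivial zero, so the width `M` of the
strip drops out. The factor `1/2` is the halving of the residue sum. -/
lemma sum_oddResidue {m : ℤ} (hm : Odd m) {k : ℕ} (hk : 1 ≤ k) {M : ℤ} (hM : 1 ≤ M) :
    1 / 2 * ∑ n ∈ Finset.Icc (1 - M) (m + M), oddResidue m k n =
      (2 : ℂ) ^ (2 * k * m - k) * (Real.pi : ℂ) ^ (2 * k * m + 2 * k - 1) * bernoulliSum m k := by
  have hk0 : k ≠ 0 := by omega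
  have hsub : Finset.Icc (0 : ℤ) (m + 1) ⊆ Finset.Icc (1 - M) (m + M) :=
    Finset.Icc_subset_Icc (by omega) (by omega)
  rw [← Finset.sum_subset hsub, bernoulliSum, Finset.mul_sum, Finset.mul_sum]
  · refine Finset.sum_congr rfl fun n hn => ?_
    rw [Finset.mem_Icc] at hn
    obtain ⟨N, rfl⟩ := Int.eq_ofNat_of_zero_le hn.1
    obtain ⟨N', hN'⟩ := Int.eq_ofNat_of_zero_le (show 0 ≤ m + 1 - N by omega)
    have hme : m = N + N' - 1 := by omega
    have e1 : (2 * m - 2 * (N : ℤ) + 2).toNat = 2 * N' := by omega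
    have e2 : (2 * (N : ℤ)).toNat = 2 * N := by omega
    have hpi : (Real.pi : ℂ) ≠ 0 := by exact_mod_cast Real.pi_ne_zero
    -- The signs of the two Euler formulas cancel since `N + N' = m + 1` is even; the sign
    -- `(-1)^(n+1)` comes from the derivative of the cosine.
    have hsign : (-1 : ℂ) ^ (N + 1) * (-1 : ℂ) ^ (N' + 1) = 1 := by
      rw [← pow_add]
      refine Even.neg_one_pow ?_
      obtain ⟨r, hr⟩ := hm
      exact ⟨(r + 2).toNat, by omega⟩
    have hzz : riemannZeta (2 * N) * riemannZeta (2 * N') =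
        (2 * Real.pi : ℂ) ^ (2 * (N + N')) * (bernoulli (2 * N') * bernoulli (2 * N)) /
          (4 * ((2 * N').factorial * (2 * N).factorial)) := by
      rw [riemannZeta_two_mul_nat_eq, riemannZeta_two_mul_nat_eq, div_mul_div_comm,
        show (4 : ℂ) * ((2 * N').factorial * (2 * N).factorial) =
          2 * (2 * N).factorial * (2 * (2 * N').factorial) by ring]
      congr 1
      rw [mul_add 2 N N', pow_add]
      linear_combination ((2 * Real.pi : ℂ) ^ (2 * N) * (2 * Real.pi : ℂ) ^ (2 * N') *
        (bernoulli (2 * N') * bernoulli (2 * N))) * hsign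
    have hz : riemannZeta (2 * ((N : ℤ) : ℂ)) ^ k * riemannZeta (2 * (m + 1 - (N : ℤ))) ^ k =
        ((2 * Real.pi : ℂ) ^ (2 * (N + N')) * (bernoulli (2 * N') * bernoulli (2 * N)) /
          (4 * ((2 * N').factorial * (2 * N).factorial))) ^ k := by
      rw [← hzz, mul_pow]
      congr 4
      rw [hme]
      push_cast
      ring
    have hp2 : (2 : ℂ) ^ (2 * k * m - k) = 2 ^ (2 * (N + N') * k) / 2 ^ (3 * k) := by
      rw [← zpow_natCast, ← zpow_natCast, ← zpow_sub₀ two_ne_zero]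
      congr 1
      rw [hme]
      push_cast
      ring
    have hpp : (Real.pi : ℂ) ^ (2 * k * m + 2 * k - 1) =
        (Real.pi : ℂ) ^ (2 * (N + N') * k) / Real.pi := by
      rw [← zpow_natCast, div_eq_mul_inv, ← zpow_sub_one₀ hpi]
      congr 1
      rw [hme]
      push_cast
      ring
    have h8 : (2 : ℂ) ^ (3 * k) = 2 ^ k * 4 ^ k := by
      rw [pow_mul, ← mul_pow]
      norm_num
    rw [oddResidue, mul_assoc (((2 : ℂ) ^ k)⁻¹), hz, e1, e2, hp2, hpp, h8, div_pow, mul_pow,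
      mul_pow, mul_pow, mul_pow, ← pow_mul, mul_pow, zpow_natCast,
      show ((N : ℤ) + 1) = ((N + 1 : ℕ) : ℤ) by push_cast; rfl, zpow_natCast, pow_succ,
      mul_pow _ _ k]
    rcases neg_one_pow_eq_or ℂ N with h | h <;> rw [h, ← pow_mul] <;> field_simp
  · intro n _ hn
    rw [Finset.mem_Icc, not_and_or, not_le, not_le] at hn
    rcases hn with hn | hn
    · rw [oddResidue, riemannZeta_two_mul_int_of_neg hn, zero_pow hk0]
      simp
    · have : riemannZeta (2 * (m + 1 - n : ℂ)) = 0 := by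
        have := riemannZeta_two_mul_int_of_neg (n := m + 1 - n) (by omega)
        push_cast at this
        exact this
      rw [oddResidue, this, zero_pow hk0]
      simp

/-! ### The contour argument and the two identities -/

lemma exists_odd_of_cos_eq_zero {w : ℂ} (hw : Complex.cos (Real.pi * w / 2) = 0) :
    ∃ j : ℤ, w = 2 * j + 1 := by
  obtain ⟨j, hj⟩ := Complex.cos_eq_zero_iff.mp hw
  have hpi : (Real.pi : ℂ) ≠ 0 := by exact_mod_cast Real.pi_ne_zero
  refine ⟨j, mul_left_cancel₀ hpi ?_⟩
  linear_combination 2 * hj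

lemma integral_lerchReflected {m : ℤ} (hm : Odd m) {k : ℕ} (hk : 1 ≤ k) {M : ℤ} (hM : 1 ≤ M)
    (hmM : 0 < m + M)
    (hint : MeasureTheory.Integrable
      (fun y : ℝ => lerchReflected m k ((2 * M : ℝ) + y * Complex.I))) :
    1 / (2 * Real.pi) * ∫ y : ℝ, lerchReflected m k ((2 * M : ℝ) + y * Complex.I) =
      iteratedDeriv (k - 1) (lerchNumerator m k) 0 / (k - 1).factorial +
        1 / 2 * ∑ n ∈ Finset.Icc (1 - M) (m + M), oddResidue m k n := by
  set b : ℝ := 2 * M with hb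
  -- The mirror image of `b` under `w ↦ -2m - w`. Both abscissas are even, so the lines miss the odd
  -- poles.
  set a : ℝ := -2 * m - 2 * M with ha
  have hMr : (1 : ℝ) ≤ M := by exact_mod_cast hM
  have hmMr : (1 : ℝ) ≤ m + M := by exact_mod_cast hmM
  have hab : a < b := by linarith
  set R : ℂ := iteratedDeriv (k - 1) (lerchNumerator m k) 0 / (k - 1).factorial with hR
  set O : Finset ℝ := (Finset.Icc (1 - M) (m + M)).image (fun n : ℤ => (1 - 2 * n : ℝ)) with hO
  have hm0 : (0 : ℝ) ≠ -2 * m := by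
    intro h
    have : 0 = -2 * m := by exact_mod_cast h
    obtain ⟨r, hr⟩ := hm
    omega
  have h0O : (0 : ℝ) ∉ O := by
    intro h
    obtain ⟨n, -, hn⟩ := Finset.mem_image.mp h
    have : 1 - 2 * n = 0 := by exact_mod_cast hn
    omega
  have hmO : (-2 * m : ℝ) ∉ O := by
    intro h
    obtain ⟨n, -, hn⟩ := Finset.mem_image.mp h
    have : 1 - 2 * n = -2 * m := by exact_mod_cast hn
    omega
  set S : Finset ℝ := insert 0 (insert (-2 * m : ℝ) O) with hSdef
  -- The floor recovers `n` from `p = 1 - 2n`; the other branch serves both `0` and `-2m`, whose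
  -- residues agree by reflection.
  set r : ℝ → ℂ := fun p => if p ∈ O then oddResidue m k ⌊(1 - p) / 2⌋ else R with hr
  have hfloor : ∀ n : ℤ, ⌊(1 - (1 - 2 * n : ℝ)) / 2⌋ = n := by
    intro n
    rw [show (1 - (1 - 2 * n : ℝ)) / 2 = n by ring, Int.floor_intCast]
  have hres0 := hasResidue_lerchReflected_zero hm hk
  have hS : ∀ p ∈ S, a < p ∧ p < b := by
    intro p hp
    rcases Finset.mem_insert.mp hp with rfl | hp
    · constructor <;> linarith
    rcases Finset.mem_insert.mp hp with rfl | hp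
    · constructor <;> linarith
    obtain ⟨n, hn, rfl⟩ := Finset.mem_image.mp hp
    rw [Finset.mem_Icc] at hn
    have h1 : (1 - M : ℝ) ≤ n := by exact_mod_cast hn.1
    have h2 : (n : ℝ) ≤ m + M := by exact_mod_cast hn.2
    constructor <;> linarith
  have hdiff : ∀ w : ℂ, a ≤ w.re → w.re ≤ b → (∀ p ∈ S, w ≠ (p : ℂ)) →
      DifferentiableAt ℂ (lerchReflected m k) w := by
    intro w h1 h2 h3
    refine differentiableAt_lerchReflected m k ?_ ?_ fun hcos => ?_
    · simpa using h3 0 (by simp [hSdef])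
    · simpa using h3 (-2 * m) (by simp [hSdef])
    · obtain ⟨j, rfl⟩ := exists_odd_of_cos_eq_zero hcos
      have hre : (2 * j + 1 : ℂ).re = 2 * j + 1 := by simp
      rw [hre, ha] at h1
      rw [hre, hb] at h2
      have h1' : -2 * m - 2 * M ≤ 2 * j + 1 := by exact_mod_cast h1
      have h2' : 2 * j + 1 ≤ 2 * M := by exact_mod_cast h2
      refine h3 (2 * j + 1 : ℝ) ?_ (by push_cast; rfl)
      refine Finset.mem_insert_of_mem (Finset.mem_insert_of_mem (Finset.mem_image.mpr ⟨-j, ?_, ?_⟩))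
      · rw [Finset.mem_Icc]
        omega
      · push_cast
        ring
  have hres : ∀ p ∈ S, HasResidue (lerchReflected m k) p (r p) := by
    intro p hp
    rcases Finset.mem_insert.mp hp with rfl | hp
    · simp only [hr, if_neg h0O, Complex.ofReal_zero]
      exact hres0
    rcases Finset.mem_insert.mp hp with rfl | hp
    · simp only [hr, if_neg hmO]
      have h := hres0.reflect (lerchReflected_reflect hm k)
      convert h using 1
      push_cast
      ring
    · simp only [hr, if_pos hp]
      obtain ⟨n, hn, rfl⟩ := Finset.mem_image.mp hp
      rw [hfloor]
      have h := hasResidue_lerchReflected_odd (m := m) k n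
      push_cast
      exact h
  obtain ⟨A, hA⟩ := exists_norm_lerchReflected_le m k a b
  have hlim := tendsto_integral_vertical_sub hab S r hS (lerchReflected m k) hdiff hres
    (tendsto_const_mul_inv_one_add_sq A) hA
  have hrefl : ∀ y : ℝ, lerchReflected m k (a + y * Complex.I) =
      -lerchReflected m k (b + (-y : ℝ) * Complex.I) := by
    intro y
    rw [← lerchReflected_reflect hm]
    congr 1
    rw [ha, hb]
    push_cast
    ring
  have hinta : MeasureTheory.Integrable (fun y : ℝ => lerchReflected m k (a + y * Complex.I)) := by
    simp_rw [hrefl]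
    exact hint.comp_neg.neg
  have heq : ∫ y : ℝ, lerchReflected m k (a + y * Complex.I) =
      -∫ y : ℝ, lerchReflected m k (b + y * Complex.I) := by
    simp_rw [hrefl]
    rw [MeasureTheory.integral_neg,
      MeasureTheory.integral_neg_eq_self (fun y : ℝ => lerchReflected m k (b + y * Complex.I))]
  have h2 := (tendsto_integral_symm hint).sub (tendsto_integral_symm hinta)
  have key := tendsto_nhds_unique h2 hlim
  have hsum : ∑ p ∈ S, r p = R + (R + ∑ n ∈ Finset.Icc (1 - M) (m + M), oddResidue m k n) := by
    rw [hSdef, Finset.sum_insert (by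
      rw [Finset.mem_insert, not_or]
      exact ⟨hm0, h0O⟩), Finset.sum_insert hmO]
    have h3 : ∑ p ∈ O, r p = ∑ n ∈ Finset.Icc (1 - M) (m + M), oddResidue m k n := by
      rw [hO, Finset.sum_image]
      · refine Finset.sum_congr rfl fun n hn => ?_
        have : (1 - 2 * n : ℝ) ∈ O := Finset.mem_image.mpr ⟨n, hn, rfl⟩
        simp only [hr, if_pos this, hfloor]
      · intro n _ n' _ h
        dsimp only at h
        have : 1 - 2 * n = 1 - 2 * n' := by exact_mod_cast h
        omega
    rw [h3]
    simp only [hr, if_neg h0O, if_neg hmO]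
  rw [heq, hsum] at key
  have hpi : (Real.pi : ℂ) ≠ 0 := by exact_mod_cast Real.pi_ne_zero
  generalize (∫ y : ℝ, lerchReflected m k (b + y * Complex.I)) = J at *
  generalize ∑ n ∈ Finset.Icc (1 - M) (m + M), oddResidue m k n = Q at *
  have hJ : J = Real.pi * (2 * R + Q) := by linear_combination key / 2
  rw [hJ]
  field_simp

/-- The generalized Lerch identity. -/
theorem hasSum_generalized_lerch {m : ℤ} (hm : Odd m) {C : ℝ} (hC : C < 0) {k : ℕ} (hk : 1 ≤ k) :
    HasSum (fun n : ℕ+ => (piltz k n : ℂ) / (n : ℂ) ^ (2 * m + 1) *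
        psi C ((2 * Real.pi) ^ k) k n)
      (1 / ((k - 1).factorial : ℂ) * iteratedDeriv (k - 1) (lerchNumerator m k) 0 +
        (2 : ℂ) ^ (2 * k * m - k) * (Real.pi : ℂ) ^ (2 * k * m + 2 * k - 1) *
          bernoulliSum m k) := by
  -- Large enough for both Dirichlet series to converge on `Re w = 2M`, and for `0` and `-2m` to lie
  -- inside the strip.
  set M : ℤ := |m| + 1 with hM
  have hM1 : 1 ≤ M := by have := abs_nonneg m; omega
  have hmM : 0 < m + M := by have := neg_abs_le m; omega
  have hMr : (1 : ℝ) ≤ M := by exact_mod_cast hM1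
  have hmMr : (1 : ℝ) ≤ m + M := by exact_mod_cast hmM
  have hρ : 0 < (2 * Real.pi) ^ k := pow_pos Real.two_pi_pos k
  have hc : (1 : ℝ) < 2 * M := by linarith
  have hcm : (1 : ℝ) < 2 * m + 1 + 2 * M := by linarith
  have hline : ∀ y : ℝ, lerchKernel m k ((2 * Real.pi) ^ k) ((2 * M : ℝ) + y * Complex.I) =
      lerchReflected m k ((2 * M : ℝ) + y * Complex.I) := by
    intro y
    have hre : (((2 * M : ℝ) : ℂ) + y * Complex.I).re = 2 * M := by simp
    refine lerchKernel_eq_lerchReflected hk m ?_ ?_ ?_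
    · intro n h
      rw [h] at hre
      simp at hre
      linarith [n.cast_nonneg (α := ℝ)]
    · intro h
      rw [h] at hre
      simp at hre
      linarith
    · intro hcos
      obtain ⟨j, hj⟩ := exists_odd_of_cos_eq_zero hcos
      rw [hj] at hre
      have hre' : (2 * j + 1 : ℂ).re = 2 * j + 1 := by simp
      rw [hre'] at hre
      have : 2 * j + 1 = 2 * M := by exact_mod_cast hre
      omega
  have hint := integrable_lerchKernel hk m hρ hc hcm
  have h := hasSum_lerch hk m hC hρ hc hcm
  simp_rw [hline] at hint h
  rw [integral_lerchReflected hm hk hM1 hmM hint, sum_oddResidue hm hk hM1] at h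
  rwa [one_div_mul_eq_div]

/-- Lerch's identity. -/
theorem hasSum_lerch_exp {m : ℤ} (hm : Odd m) :
    HasSum (fun n : ℕ+ => 1 / ((n : ℂ) ^ (2 * m + 1) * (Complex.exp (2 * Real.pi * n) - 1)))
      (-riemannZeta (2 * m + 1) / 2 +
        (2 : ℂ) ^ (2 * m - 1) * (Real.pi : ℂ) ^ (2 * m + 1) * bernoulliSum m 1) := by
  have h := hasSum_generalized_lerch hm (C := -1) (by norm_num) (k := 1) le_rfl
  have e : 1 / ((1 - 1 : ℕ).factorial : ℂ) * iteratedDeriv (1 - 1) (lerchNumerator m 1) 0 =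
      -riemannZeta (2 * m + 1) / 2 := by
    simp [lerchNumerator, riemannZeta_zero]
    ring
  have e2 : 2 * ((1 : ℕ) : ℤ) * m - (1 : ℕ) = 2 * m - 1 := by push_cast; ring
  have e3 : 2 * ((1 : ℕ) : ℤ) * m + 2 * (1 : ℕ) - 1 = 2 * m + 1 := by push_cast; ring
  rw [e, e2, e3] at h
  refine (congrArg (fun f => HasSum f _) (funext fun n : ℕ+ => ?_)).mpr h
  have hn : 0 < (n : ℝ) := by exact_mod_cast n.pos
  rw [piltz_one n.ne_zero, pow_one, psi_one_eq (by norm_num) Real.two_pi_pos hn]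
  push_cast
  rw [div_mul_div_comm, one_mul]

end

/-- Over ℂ, `Summable` and `HasSum` mean unconditional, hence absolute, convergence. -/
theorem theorem1p7 (m : ℤ) (hm : Odd m) (C : ℝ) (hC : C < 0) :
    (∀ k : ℕ, 1 ≤ k →
      (∀ n j : ℕ+, MeasureTheory.Integrable (fun y : ℝ =>
        meijerIntegrand (k + 1) 0 (Fin.elim0 : Fin 0 → ℂ) (psiParam k)
          ((((2 * Real.pi) ^ k) ^ 2 * (j : ℝ) ^ 2 * (n : ℝ) ^ 2 / 2 ^ (2 * k) : ℝ) : ℂ)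
          (C + y * Complex.I))) ∧
      (∀ n : ℕ+, Summable (fun j : ℕ+ => psiTerm C ((2 * Real.pi) ^ k) k n j)) ∧
      HasSum
        (fun n : ℕ+ => (piltz k n : ℂ) / (n : ℂ) ^ (2 * m + 1) *
          psi C ((2 * Real.pi) ^ k) k n)
        (1 / ((k - 1).factorial : ℂ) *
            iteratedDeriv (k - 1) (fun s : ℂ =>
              riemannZeta (2 * m + 1 + s) ^ k * riemannZeta s ^ k * Complex.Gamma (s + 1) ^ k *
                Complex.cos (Real.pi * s / 2) ^ (k - 1) *
                (2 * Real.pi : ℂ) ^ (-(k * s))) 0 +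
          (2 : ℂ) ^ (2 * k * m - k) * (Real.pi : ℂ) ^ (2 * k * m + 2 * k - 1) *
            bernoulliSum m k)) ∧
    -- the case `k = 1` is Lerch's identity
    (∀ n : ℕ+, psi C (2 * Real.pi) 1 n = 1 / (Complex.exp (2 * Real.pi * n) - 1)) ∧
    Summable (fun n : ℕ+ =>
      1 / ((n : ℂ) ^ (2 * m + 1) * (Complex.exp (2 * Real.pi * n) - 1))) ∧
    riemannZeta (2 * m + 1) + 2 * ∑' n : ℕ+,
        1 / ((n : ℂ) ^ (2 * m + 1) * (Complex.exp (2 * Real.pi * n) - 1)) =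
      (2 : ℂ) ^ (2 * m) * (Real.pi : ℂ) ^ (2 * m + 1) *
        ∑ j ∈ Finset.Icc (0 : ℤ) (m + 1),
          (-1 : ℂ) ^ (j + 1) *
            ((bernoulli (2 * j).toNat : ℂ) * (bernoulli (2 * m + 2 - 2 * j).toNat : ℂ)) /
              (((2 * j).toNat.factorial : ℂ) * ((2 * m + 2 - 2 * j).toNat.factorial : ℂ)) := by
  have hcast : ∀ n : ℕ+, 0 < (n : ℝ) := fun n => by exact_mod_cast n.pos
  refine ⟨fun k hk => ?_, fun n => ?_, (hasSum_lerch_exp hm).summable, ?_⟩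
  · have hρ : 0 < (2 * Real.pi) ^ k := pow_pos Real.two_pi_pos k
    refine ⟨fun n j => ?_, fun n => summable_psiTerm hk hC hρ (hcast n),
      hasSum_generalized_lerch hm hC hk⟩
    have e : (((2 * Real.pi) ^ k) ^ 2 * (j : ℝ) ^ 2 * (n : ℝ) ^ 2 / 2 ^ (2 * k) : ℝ) =
        ((2 * Real.pi) ^ k * j * n) ^ 2 / 2 ^ (2 * k) := by ring
    rw [e]
    exact integrable_meijerIntegrand hk (mul_pos (mul_pos hρ (hcast j)) (hcast n)) hC
  · rw [psi_one_eq hC Real.two_pi_pos (hcast n)]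
    push_cast
    rfl
  · have h2 : (2 : ℂ) ^ (2 * m) = 2 * 2 ^ (2 * m - 1) := by
      rw [zpow_sub_one₀ two_ne_zero]
      field_simp
    have hB : bernoulliSum m 1 = ∑ j ∈ Finset.Icc (0 : ℤ) (m + 1), (-1 : ℂ) ^ (j + 1) *
        ((bernoulli (2 * j).toNat : ℂ) * (bernoulli (2 * m + 2 - 2 * j).toNat : ℂ)) /
          (((2 * j).toNat.factorial : ℂ) * ((2 * m + 2 - 2 * j).toNat.factorial : ℂ)) := by
      refine Finset.sum_congr rfl fun j _ => ?_
      rw [show 2 * m - 2 * j + 2 = 2 * m + 2 - 2 * j by ring, pow_one, pow_one, pow_one]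
      congr 1
      · ring
      · ring
    rw [(hasSum_lerch_exp hm).tsum_eq, ← hB, h2]
    ring
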